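/- For $m,k\in\mathbb N_0$ and elements $a,b$ of a ring let $S_{m,k}(a,b)$ be the sum of all words of length $m$ in the letters $a,b$ in which $b$ occurs exactly $k$ times. Let $\mathbb R\langle X,Y\rangle$ be the algebra of real polynomials in two noncommuting variables, with the involution $*$ that fixes $\mathbb R\cup\{X,Y\}$ pointwise (and thus reverses words). For $f,g\in\mathbb R\langle X,Y\rangle$ write $f\sim_{\mathrm{cyc}}g$ if $f-g$ is a finite sum of commutators $pq-qp$ with $p,q\in\mathbb R\langle X,Y\rangle$. A hermitian square is an element of the form $g^*g$ with $g\in\mathbb R\langle X,Y\rangle$. Then the following hold. (1) (The BMV conjecture for $m=13$.) For every $n$ and all positive semidefinite hermitian $n\times n$ matrices $A,B$ over $\mathbb C$, the polynomial $\operatorname{tr}((A+tB)^{13})$ has real, nonnegative coefficients. (2) $S_{14,4}(X^2,Y^2)\sim_{\mathrm{cyc}}\sum_{i=1}^4 g_i^*g_i$, where $$\begin{aligned} g_1&=\sqrt7\,(Y^2X^{10}Y^2+X^4Y^2X^6Y^2+X^2Y^2X^8Y^2+X^{10}Y^4+X^8Y^2X^2Y^2+X^6Y^2X^4Y^2),\\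 g_2&=\sqrt7\,(X^4Y^2X^2Y^2X^4+X^6Y^4X^4+X^4Y^2X^4Y^2X^2+X^8Y^4X^2+X^6Y^2X^2Y^2X^2),\\ g_3&=\sqrt7\,X^6Y^4X^4,\\ g_4&=\sqrt7\,(X^2Y^2X^6Y^2X^2+X^4Y^2X^4Y^2X^2+X^8Y^4X^2+X^6Y^2X^2Y^2X^2+X^4Y^2X^6Y^2\\ &\qquad\ \ +X^2Y^2X^8Y^2+X^{10}Y^4+X^8Y^2X^2Y^2+X^6Y^2X^4Y^2). \end{aligned}$$ (3) There is a finite sum $h$ of hermitian squares such that $S_{14,6}(X^2,Y^2)\sim_{\mathrm{cyc}}10^{-7}\,S_{7,3}(X^2,Y^2)^2+h$. (4) Let $n\ge 0$, $m\ge1$ and $0\le k\le m$, and suppose that $(A,B)$ minimizes $\operatorname{tr}(S_{m,k}(A^2,B^2))$ among all pairs of real symmetric $n\times n$ matrices of Hilbert–Schmidt norm $1$, and that $A$ and $B$ are positive semidefinite. Then $$A\,S_{m-1,k}(A^2,B^2)=\tfrac{m-k}{m}\operatorname{tr}(S_{m,k}(A^2,B^2))\,A$$ and, if $k\ge1$,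 $$B\,S_{m-1,k-1}(A^2,B^2)=\tfrac{k}{m}\operatorname{tr}(S_{m,k}(A^2,B^2))\,B.$$ -/

import Mathlib

open scoped ComplexOrder

/-- `Smk m k a b`, the polynomial `S_{m,k}` evaluated at `(a, b)`: the sum of all words of length `m`
in the two letters `a`, `b` in which `b` occurs exactly `k` times. Such a word is given by the
`k`-element set `s` of the positions of `b`. -/
def Smk {R : Type*} [Semiring R] (m k : ℕ) (a b : R) : R :=
  ∑ s ∈ Finset.powersetCard k (Finset.univ : Finset (Fin m)),
    (List.ofFn fun i : Fin m => if i ∈ s then b else a).prod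

/-- The BMV conjecture (algebraic form) for the exponent `m`: for all positive semidefinite
(hermitian) complex `n × n` matrices `A`, `B`, the polynomial `tr ((A + t B) ^ m)` in `t` is a real
polynomial all of whose coefficients are nonnegative. -/
def BMVConjectureFor (m : ℕ) : Prop :=
  ∀ (n : ℕ) (A B : Matrix (Fin n) (Fin n) ℂ), A.PosSemidef → B.PosSemidef →
    ∃ p : Polynomial ℝ,
      p.map (algebraMap ℝ ℂ) =
        ((A.map Polynomial.C + (Polynomial.X : Polynomial ℂ) • B.map Polynomial.C) ^ m).trace ∧
      ∀ k : ℕ, 0 ≤ p.coeff k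

/-- The algebra of real polynomials in two noncommuting variables. Its `star` is the involution that
fixes the reals and both variables, so it reverses words. -/
abbrev NCPoly : Type := FreeAlgebra ℝ (Fin 2)

namespace NCPoly

/-- The first variable. -/
def X : NCPoly := FreeAlgebra.ι ℝ 0

/-- The second variable. -/
def Y : NCPoly := FreeAlgebra.ι ℝ 1

/-- Cyclic equivalence: the difference is a (finite) sum of commutators. -/
def CycEquiv (f g : NCPoly) : Prop :=
  f - g ∈ AddSubmonoid.closure {c : NCPoly | ∃ p q : NCPoly, c = p * q - q * p}

/-- The finite sums of hermitian squares `g* g`. -/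
def SumHermSq : AddSubmonoid NCPoly :=
  AddSubmonoid.closure {h : NCPoly | ∃ g : NCPoly, h = star g * g}

/-- `g₁ / √7` in the certificate for `S_{14,4}(X², Y²)`. -/
def g1 : NCPoly :=
  Y ^ 2 * X ^ 10 * Y ^ 2 + X ^ 4 * Y ^ 2 * X ^ 6 * Y ^ 2 + X ^ 2 * Y ^ 2 * X ^ 8 * Y ^ 2
    + X ^ 10 * Y ^ 4 + X ^ 8 * Y ^ 2 * X ^ 2 * Y ^ 2 + X ^ 6 * Y ^ 2 * X ^ 4 * Y ^ 2

/-- `g₂ / √7` in the certificate for `S_{14,4}(X², Y²)`. -/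
def g2 : NCPoly :=
  X ^ 4 * Y ^ 2 * X ^ 2 * Y ^ 2 * X ^ 4 + X ^ 6 * Y ^ 4 * X ^ 4
    + X ^ 4 * Y ^ 2 * X ^ 4 * Y ^ 2 * X ^ 2 + X ^ 8 * Y ^ 4 * X ^ 2
    + X ^ 6 * Y ^ 2 * X ^ 2 * Y ^ 2 * X ^ 2

/-- `g₃ / √7` in the certificate for `S_{14,4}(X², Y²)`. -/
def g3 : NCPoly := X ^ 6 * Y ^ 4 * X ^ 4

/-- `g₄ / √7` in the certificate for `S_{14,4}(X², Y²)`. -/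
def g4 : NCPoly :=
  X ^ 2 * Y ^ 2 * X ^ 6 * Y ^ 2 * X ^ 2 + X ^ 4 * Y ^ 2 * X ^ 4 * Y ^ 2 * X ^ 2
    + X ^ 8 * Y ^ 4 * X ^ 2 + X ^ 6 * Y ^ 2 * X ^ 2 * Y ^ 2 * X ^ 2
    + X ^ 4 * Y ^ 2 * X ^ 6 * Y ^ 2 + X ^ 2 * Y ^ 2 * X ^ 8 * Y ^ 2
    + X ^ 10 * Y ^ 4 + X ^ 8 * Y ^ 2 * X ^ 2 * Y ^ 2 + X ^ 6 * Y ^ 2 * X ^ 4 * Y ^ 2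

end NCPoly

/-- The real symmetric `n × n` matrices of Hilbert-Schmidt norm `1`. -/
def symmHSSphere (n : ℕ) : Set (Matrix (Fin n) (Fin n) ℝ) :=
  {A | A.IsSymm ∧ √(∑ i, ∑ j, A i j ^ 2) = 1}

/-! The coefficient of `t ^ k` in `tr ((A + t B) ^ 13)` is `tr S_{13,k}(A, B)`, so part (1) asks for
the nonnegativity of these traces. They are reached from degree 14 by descent. Suppose `tr
S_{m,k}(A², B²)` is negative somewhere and `k < m`. By homogeneity and compactness it has a negative
minimum `c` over pairs of hermitian matrices of norm one, attained at positive semidefinite `A`,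
`B`. The Euler-Lagrange equations (`minimizer_equation_left`, `minimizer_equation_right`), which are
part (4), give `S_{m,k}(A², B²) = λ A² + μ B²` with `λ = (m-k)c/m < 0` and `μ = kc/m ≤ 0`. Hence `tr
(A² S_{m,k}(A², B²)) < 0`. But this trace is a positive multiple of `tr S_{m+1,k}(A², B²)`, so
nonnegativity in degree `m + 1` passes to degree `m` (`reTrace_smk_nonneg_of_succ`).

For `m = 13` exchanging the letters turns odd `k` into even `13 - k`, so only `tr S_{14,k}` with `k`
even is needed, and by the same symmetry only `k = 0, 2, 4, 6`. The first two are elementary; the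
last two follow from the sums of hermitian squares in (2) and (3).

Those certificates are finite integer computations. A word is a binary number, a cyclic class is
represented by the least rotation, and a cyclic equivalence becomes the cancellation of all integer
coefficients (`cyc_ofList_eq_zero`). For `S_{14,6}` the squares come from integer Gram matrices
whose positivity is checked by elimination (`quadForm_mem_sumHermSq`). -/

section SmkBasic

/-! ### Recursions, symmetry and homogeneity of `Smk`. -/

variable {R : Type*} [Semiring R]

theorem smk_zero_right_zero (a b : R) : Smk 0 0 a b = 1 := by
  simp [Smk]

theorem smk_of_lt {m k : ℕ} (h : m < k) (a b : R) : Smk m k a b = 0 := by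
  simp [Smk, Finset.powersetCard_eq_empty.2
    (by simpa using h : (Finset.univ : Finset (Fin m)).card < k)]

theorem smk_succ_zero (m : ℕ) (a b : R) : Smk (m + 1) 0 a b = a * Smk m 0 a b := by
  simp [Smk, List.ofFn_succ]

theorem smk_zero_right (m : ℕ) (a b : R) : Smk m 0 a b = a ^ m := by
  induction m with
  | zero => simp [smk_zero_right_zero]
  | succ m ih => rw [smk_succ_zero, ih, pow_succ']

/-- Words are split by their first letter: position `0` either lies outside the set of positions of
`b` or is inserted into it. -/
theorem smk_succ_succ (m k : ℕ) (a b : R) :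
    Smk (m + 1) (k + 1) a b = a * Smk m (k + 1) a b + b * Smk m k a b := by
  unfold Smk
  rw [Fin.univ_succ, Finset.cons_eq_insert, Finset.powersetCard_succ_insert (by simp),
    Finset.sum_union, Finset.sum_image, Finset.powersetCard_map, Finset.powersetCard_map,
    Finset.sum_map, Finset.sum_map, Finset.mul_sum, Finset.mul_sum]
  · congr 1
    · refine Finset.sum_congr rfl fun s _ => ?_
      simp [List.ofFn_succ, Finset.mapEmbedding]
    · refine Finset.sum_congr rfl fun s _ => ?_
      simp [List.ofFn_succ, Finset.mapEmbedding]
  · intro s hs t ht hst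
    have h0 : ∀ u : Finset (Fin (m + 1)), u ∈ Finset.powersetCard k
        (Finset.map ⟨Fin.succ, Fin.succ_injective m⟩ Finset.univ) → (0 : Fin (m + 1)) ∉ u := by
      intro u hu h
      have := (Finset.mem_powersetCard.1 hu).1 h
      simp at this
    rw [← Finset.erase_insert (h0 s (Finset.mem_coe.1 hs)),
      ← Finset.erase_insert (h0 t (Finset.mem_coe.1 ht)), hst]
  · rw [Finset.disjoint_left]
    intro u hu hu'
    obtain ⟨v, _, rfl⟩ := Finset.mem_image.1 hu'
    have := (Finset.mem_powersetCard.1 hu).1 (Finset.mem_insert_self _ _)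
    simp at this

/-- `S_{m,k}(a, b)` is the coefficient of `t ^ k` in `(a + t b) ^ m`. -/
theorem coeff_pencil_pow (m k : ℕ) (a b : R) :
    ((Polynomial.C a + Polynomial.C b * Polynomial.X) ^ m).coeff k = Smk m k a b := by
  induction m generalizing k with
  | zero =>
    cases k with
    | zero => simp [smk_zero_right_zero]
    | succ k => simp [smk_of_lt, Polynomial.coeff_one]
  | succ m ih =>
    rw [pow_succ', add_mul, Polynomial.coeff_add, Polynomial.coeff_C_mul, mul_assoc,
      Polynomial.coeff_C_mul, ih]
    cases k with
    | zero => simp [smk_succ_zero]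
    | succ k => rw [Polynomial.coeff_X_mul, ih, smk_succ_succ]

theorem smk_succ_zero' (m : ℕ) (a b : R) : Smk (m + 1) 0 a b = Smk m 0 a b * a := by
  simp [smk_zero_right, pow_succ]

/-- Splitting by the last letter is invisible in the first-letter recursion, but it is immediate
from `p ^ (m + 1) = p ^ m * p` for the pencil `p`. -/
theorem smk_succ_succ' (m k : ℕ) (a b : R) :
    Smk (m + 1) (k + 1) a b = Smk m (k + 1) a b * a + Smk m k a b * b := by
  simp only [← coeff_pencil_pow]
  rw [pow_succ, mul_add, Polynomial.coeff_add, ← mul_assoc, Polynomial.coeff_mul_X,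
    Polynomial.coeff_mul_C, Polynomial.coeff_mul_C]

theorem map_smk {S F : Type*} [Semiring S] [FunLike F R S] [RingHomClass F R S] (f : F) (m k : ℕ)
    (a b : R) : f (Smk m k a b) = Smk m k (f a) (f b) := by
  unfold Smk
  rw [map_sum]
  refine Finset.sum_congr rfl fun s _ => ?_
  rw [map_list_prod, List.map_ofFn]
  congr 2
  funext i
  simp only [Function.comp]
  split_ifs <;> rfl

/-- This symmetry carries every statement about the first letter over to the second. -/
theorem smk_swap {m k : ℕ} (h : k ≤ m) (a b : R) : Smk m k a b = Smk m (m - k) b a := by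
  induction m generalizing k with
  | zero => obtain rfl : k = 0 := by omega
            simp [smk_zero_right_zero]
  | succ m ih =>
    cases k with
    | zero =>
      rw [Nat.sub_zero, smk_succ_zero, smk_succ_succ, smk_of_lt (Nat.lt_succ_self m), mul_zero,
        zero_add, ih (Nat.zero_le m), Nat.sub_zero]
    | succ k =>
      rw [smk_succ_succ, ih (by omega : k ≤ m), Nat.add_sub_add_right]
      rcases Nat.lt_or_ge k m with hk | hk
      · obtain ⟨j, hj⟩ : ∃ j, m - k = j + 1 := ⟨m - k - 1, by omega⟩
        rw [ih (by omega : k + 1 ≤ m), hj, smk_succ_succ, show m - (k + 1) = j by omega, add_comm]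
      · rw [smk_of_lt (by omega), show m - k = 0 by omega, smk_succ_zero, mul_zero, zero_add]

theorem star_smk [StarRing R] (m k : ℕ) (a b : R) :
    star (Smk m k a b) = Smk m k (star a) (star b) := by
  induction m generalizing k with
  | zero =>
    cases k with
    | zero => simp [smk_zero_right_zero]
    | succ k => simp [smk_of_lt]
  | succ m ih =>
    cases k with
    | zero => rw [smk_succ_zero, star_mul, ih, smk_succ_zero']
    | succ k => rw [smk_succ_succ, star_add, star_mul, star_mul, ih, ih, smk_succ_succ']

/-- Expansion of a power of a pencil with a central parameter. -/
theorem pencil_pow_eq_sum {K : Type*} [CommSemiring K] [Algebra K R] (m : ℕ) (a b : R) (t : K) :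
    (a + t • b) ^ m = ∑ k ∈ Finset.range (m + 1), t ^ k • Smk m k a b := by
  induction m with
  | zero => simp [smk_zero_right_zero]
  | succ m ih =>
    rw [pow_succ', ih, Finset.sum_range_succ' _ (m + 1), smk_succ_zero, pow_zero, one_smul]
    simp only [smk_succ_succ, smul_add, Finset.sum_add_distrib]
    rw [add_mul, Finset.mul_sum, Finset.mul_sum, Finset.sum_range_succ' _ m,
      Finset.sum_range_succ (fun k => t ^ (k + 1) • (a * Smk m (k + 1) a b)) m,
      smk_of_lt (Nat.lt_succ_self m)]
    simp only [mul_smul_comm, smul_mul_assoc, smul_smul, pow_succ', pow_zero, one_smul, mul_zero,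
      smul_zero, add_zero, mul_comm t]
    abel

theorem smk_smul_left {K : Type*} [CommSemiring K] [Algebra K R] {m k : ℕ} (h : k ≤ m) (a b : R)
    (r : K) : Smk m k (r • a) b = r ^ (m - k) • Smk m k a b := by
  induction m generalizing k with
  | zero => obtain rfl : k = 0 := by omega
            simp [smk_zero_right_zero]
  | succ m ih =>
    cases k with
    | zero => simp [smk_zero_right, smul_pow]
    | succ k =>
      rw [smk_succ_succ, smk_succ_succ, ih (by omega : k ≤ m), Nat.add_sub_add_right, smul_add,
        mul_smul_comm]
      rcases Nat.lt_or_ge k m with hk | hk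
      · rw [ih (by omega : k + 1 ≤ m), show m - k = m - (k + 1) + 1 by omega, pow_succ',
          smul_mul_assoc, mul_smul_comm, smul_smul]
      · rw [smk_of_lt (show m < k + 1 by omega), smk_of_lt (show m < k + 1 by omega)]; simp

end SmkBasic

namespace NCPoly

/-! ### Tracial quotient -/

/-- The real span of the commutators. -/
def commutators : Submodule ℝ NCPoly :=
  Submodule.span ℝ {c : NCPoly | ∃ p q : NCPoly, c = p * q - q * p}

/-- The universal tracial functional. -/
def cyc : NCPoly →ₗ[ℝ] NCPoly ⧸ commutators := commutators.mkQ

theorem cyc_mul_comm (p q : NCPoly) : cyc (p * q) = cyc (q * p) := by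
  rw [cyc, Submodule.mkQ_apply, Submodule.mkQ_apply, Submodule.Quotient.eq]
  exact Submodule.subset_span ⟨p, q, rfl⟩

theorem cycEquiv_iff (f g : NCPoly) : CycEquiv f g ↔ cyc f = cyc g := by
  rw [cyc, Submodule.mkQ_apply, Submodule.mkQ_apply, Submodule.Quotient.eq, CycEquiv]
  constructor
  · intro h
    have : AddSubmonoid.closure {c : NCPoly | ∃ p q : NCPoly, c = p * q - q * p}
        ≤ commutators.toAddSubmonoid := AddSubmonoid.closure_le.2 Submodule.subset_span
    exact this h
  · intro h
    rw [commutators] at h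
    generalize f - g = z at h ⊢
    induction h using Submodule.span_induction with
    | mem x hx => exact AddSubmonoid.subset_closure hx
    | zero => exact zero_mem _
    | add x y _ _ hx hy => exact add_mem hx hy
    | smul r x hx₀ hx =>
      clear hx₀
      induction hx using AddSubmonoid.closure_induction with
      | mem x hx =>
        obtain ⟨p, q, rfl⟩ := hx
        -- A scalar is absorbed into one factor of the commutator, so sums of commutators already
        -- form a real subspace.
        exact AddSubmonoid.subset_closure ⟨r • p, q, by simp [smul_sub]⟩
      | zero => simp
      | add x y _ _ hx hy => rw [smul_add]; exact add_mem hx hy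

theorem star_smul' (r : ℝ) (p : NCPoly) : star (r • p) = r • star p := by
  rw [Algebra.smul_def, Algebra.smul_def, star_mul, FreeAlgebra.star_algebraMap, Algebra.commutes]

theorem star_X : star X = X := FreeAlgebra.star_ι 0

theorem star_Y : star Y = Y := FreeAlgebra.star_ι 1

/-- The substitution `X ↦ X ^ 2`, `Y ↦ Y ^ 2`. -/
def sqSubst : NCPoly →ₐ[ℝ] NCPoly := FreeAlgebra.lift ℝ ![X ^ 2, Y ^ 2]

@[simp] theorem sqSubst_X : sqSubst X = X ^ 2 := by simp [sqSubst, X]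

@[simp] theorem sqSubst_Y : sqSubst Y = Y ^ 2 := by simp [sqSubst, Y]

theorem sqSubst_star (p : NCPoly) : sqSubst (star p) = star (sqSubst p) := by
  refine FreeAlgebra.induction ℝ (Fin 2) (motive := fun p => sqSubst (star p) = star (sqSubst p))
    ?_ ?_ ?_ ?_ p
  · intro r
    rw [FreeAlgebra.star_algebraMap, AlgHom.commutes, FreeAlgebra.star_algebraMap]
  · intro i
    fin_cases i
    · change sqSubst (star X) = star (sqSubst X)
      simp [star_X]
    · change sqSubst (star Y) = star (sqSubst Y)
      simp [star_Y]
  · intro p q hp hq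
    simp only [star_mul, map_mul, hp, hq]
  · intro p q hp hq
    simp only [star_add, map_add, hp, hq]

theorem cyc_sqSubst {p q : NCPoly} (h : cyc p = cyc q) : cyc (sqSubst p) = cyc (sqSubst q) := by
  have : commutators ≤ LinearMap.ker (cyc ∘ₗ sqSubst.toLinearMap) := by
    refine Submodule.span_le.2 ?_
    rintro _ ⟨p, q, rfl⟩
    simp [cyc_mul_comm (sqSubst p)]
  have h1 : p - q ∈ commutators := by
    rwa [cyc, Submodule.mkQ_apply, Submodule.mkQ_apply, Submodule.Quotient.eq] at h
  have h2 := this h1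
  simpa [sub_eq_zero] using h2

/-! ### Words coded by natural numbers -/

/-- The letter coded by the parity of `c`. -/
def letter (c : ℕ) : NCPoly := if c % 2 = 0 then X else Y

/-- The word of length `n` coded by the last `n` binary digits of `k`. -/
def word : ℕ → ℕ → NCPoly
  | 0, _ => 1
  | n + 1, k => word n (k / 2) * letter k

/-- Reducing `v` modulo `2 ^ m` keeps exactly the digits that `word m` reads, so no bound on codes
has to be carried along. -/
theorem word_append (n m u v : ℕ) : word (n + m) (u * 2 ^ m + v % 2 ^ m) = word n u * word m v := by
  induction m generalizing v with
  | zero => simp [word, Nat.mod_one]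
  | succ m ih =>
    have h1 : (u * 2 ^ (m + 1) + v % 2 ^ (m + 1)) / 2 = u * 2 ^ m + v / 2 % 2 ^ m := by
      rw [pow_succ', ← Nat.mod_mul_right_div_self]
      rw [show u * (2 * 2 ^ m) = 2 * (u * 2 ^ m) by ring, Nat.mul_add_div (by norm_num)]
    have h2 : (u * 2 ^ (m + 1) + v % 2 ^ (m + 1)) % 2 = v % 2 := by
      rw [pow_succ', show u * (2 * 2 ^ m) = 2 * (u * 2 ^ m) by ring, Nat.mul_add_mod,
        Nat.mod_mul_right_mod]
    rw [← add_assoc, word, h1, ih, word, letter, h2, mul_assoc]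
    rfl

/-- The code of the word `v` of length `n` read backwards. -/
def revCode : ℕ → ℕ → ℕ
  | 0, _ => 0
  | n + 1, k => k % 2 * 2 ^ n + revCode n (k / 2) % 2 ^ n

theorem star_letter (c : ℕ) : star (letter c) = letter c := by
  unfold letter
  split_ifs
  exacts [star_X, star_Y]

theorem star_word (n k : ℕ) : star (word n k) = word n (revCode n k) := by
  induction n generalizing k with
  | zero => simp [word]
  | succ n ih =>
    rw [word, star_mul, ih, revCode, add_comm n 1, word_append, star_letter]
    simp [word, letter]

/-- The code of the cyclic rotation of a word of length `n + 1`. -/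
def rotCode (n k : ℕ) : ℕ := k % 2 * 2 ^ n + k / 2 % 2 ^ n

theorem cyc_word_rotCode (n k : ℕ) : cyc (word (n + 1) (rotCode n k)) = cyc (word (n + 1) k) := by
  rw [rotCode, add_comm n 1, word_append, add_comm 1 n, word, cyc_mul_comm]
  simp [word, letter]

/-- The smallest code among `best` and the next `i` rotations of `k`. -/
def minRot (n : ℕ) : ℕ → ℕ → ℕ → ℕ
  | 0, _, best => best
  | i + 1, k, best => bif Nat.ble best (rotCode n k) then minRot n i (rotCode n k) best
      else minRot n i (rotCode n k) (rotCode n k)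

/-- Soundness only uses that every candidate is a rotation of `k`; minimality is what makes
equivalent words collide, and it need not be proved. -/
theorem cyc_word_minRot (n i k best : ℕ) (h : cyc (word (n + 1) best) = cyc (word (n + 1) k)) :
    cyc (word (n + 1) (minRot n i k best)) = cyc (word (n + 1) k) := by
  induction i generalizing k best with
  | zero => exact h
  | succ i ih =>
    rw [minRot]
    cases Nat.ble best (rotCode n k)
    · rw [cond_false, ih _ _ rfl, cyc_word_rotCode]
    · rw [cond_true, ih _ _ (by rw [h, cyc_word_rotCode]), cyc_word_rotCode]

/-! ### Polynomials as lists of coefficients and codes -/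

/-- The homogeneous polynomial of degree `n` given by a list of coefficients and codes. -/
def ofList (n : ℕ) (l : List (ℤ × ℕ)) : NCPoly := (l.map fun t => (t.1 : ℝ) • word n t.2).sum

theorem ofList_cons (n : ℕ) (t : ℤ × ℕ) (l : List (ℤ × ℕ)) :
    ofList n (t :: l) = (t.1 : ℝ) • word n t.2 + ofList n l := rfl

theorem ofList_append (n : ℕ) (l₁ l₂ : List (ℤ × ℕ)) :
    ofList n (l₁ ++ l₂) = ofList n l₁ + ofList n l₂ := by
  simp [ofList]

/-- Binary tries that store the coefficient of a word at the node reached by reading the word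
backwards. -/
inductive Trie
  | nil
  | node (c : ℤ) (l r : Trie)

namespace Trie

/-- The polynomial stored in a trie. -/
def eval : Trie → NCPoly
  | nil => 0
  | node c l r => (c : ℝ) • 1 + eval l * X + eval r * Y

/-- Adds `c` to the coefficient of the word of length `n` with code `k`. -/
def insert (c : ℤ) : ℕ → ℕ → Trie → Trie
  | 0, _, nil => node c nil nil
  | 0, _, node d l r => node (c + d) l r
  | n + 1, k, nil => bif Nat.beq (k % 2) 0 then node 0 (insert c n (k / 2) nil) nil
      else node 0 nil (insert c n (k / 2) nil)
  | n + 1, k, node d l r => bif Nat.beq (k % 2) 0 then node d (insert c n (k / 2) l) r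
      else node d l (insert c n (k / 2) r)

theorem eval_insert (c : ℤ) (n k : ℕ) (t : Trie) :
    (insert c n k t).eval = (c : ℝ) • word n k + t.eval := by
  induction n generalizing k t with
  | zero =>
    cases t with
    | nil => simp [insert, eval, word]
    | node d l r =>
      simp only [insert, eval, word, Int.cast_add, add_smul]
      abel
  | succ n ih =>
    have hb : ∀ b, Nat.beq (k % 2) 0 = b → (b = true ↔ k % 2 = 0) := by
      rintro _ rfl
      rw [Nat.beq_eq]
    cases t with
    | nil =>
      rw [insert]
      cases h : Nat.beq (k % 2) 0
      · have := (hb _ h)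
        simp only [cond_false, eval, ih, word, letter]
        rw [if_neg (by simpa using this)]
        simp
      · have := (hb _ h)
        simp only [cond_true, eval, ih, word, letter]
        rw [if_pos (by simpa using this)]
        simp
    | node d l r =>
      rw [insert]
      cases h : Nat.beq (k % 2) 0
      · have := (hb _ h)
        simp only [cond_false, eval, ih, word, letter]
        rw [if_neg (by simpa using this), add_mul, smul_mul_assoc]
        abel
      · have := (hb _ h)
        simp only [cond_true, eval, ih, word, letter]
        rw [if_pos (by simpa using this), add_mul, smul_mul_assoc]
        abel

/-- Checks that all coefficients vanish. -/
def isZero : Trie → Bool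
  | nil => true
  | node c l r => decide (c = 0) && (isZero l && isZero r)

theorem eval_eq_zero (t : Trie) (h : t.isZero = true) : t.eval = 0 := by
  induction t with
  | nil => rfl
  | node c l r ihl ihr =>
    rw [isZero, Bool.and_eq_true, Bool.and_eq_true, decide_eq_true_eq] at h
    simp [eval, h.1, ihl h.2.1, ihr h.2.2]

end Trie

/-- Collects the coefficients of a polynomial of degree `n + 1` along cyclic classes of words. -/
def collect (n : ℕ) : List (ℤ × ℕ) → Trie → Trie
  | [], t => t
  | (c, k) :: l, t => collect n l (Trie.insert c (n + 1) (minRot n n k k) t)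

theorem cyc_eval_collect (n : ℕ) (l : List (ℤ × ℕ)) (t : Trie) :
    cyc (collect n l t).eval = cyc (ofList (n + 1) l) + cyc t.eval := by
  induction l generalizing t with
  | nil => simp [collect, ofList]
  | cons s l ih =>
    obtain ⟨c, k⟩ := s
    rw [collect, ih, Trie.eval_insert, ofList_cons, map_add, map_add, map_smul, map_smul,
      cyc_word_minRot _ _ _ _ rfl]
    abel

theorem cyc_ofList_eq_zero (n : ℕ) (l : List (ℤ × ℕ)) (h : (collect n l .nil).isZero = true) :
    cyc (ofList (n + 1) l) = 0 := by
  have := cyc_eval_collect n l .nil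
  rw [Trie.eval_eq_zero _ h, Trie.eval, map_zero, add_zero] at this
  exact this.symm

/-- The list of the words of length `m` with `k` letters `Y`, each with coefficient `c`. -/
def smkList (c : ℤ) : ℕ → ℕ → List (ℤ × ℕ)
  | 0, 0 => [(c, 0)]
  | 0, _ + 1 => []
  | m + 1, 0 => (smkList c m 0).map fun t => (t.1, 2 * t.2)
  | m + 1, k + 1 => (smkList c m (k + 1)).map (fun t => (t.1, 2 * t.2)) ++
      (smkList c m k).map fun t => (t.1, 2 * t.2 + 1)

theorem ofList_map_two_mul (n : ℕ) (l : List (ℤ × ℕ)) :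
    ofList (n + 1) (l.map fun t => (t.1, 2 * t.2)) = ofList n l * X := by
  induction l with
  | nil => simp [ofList]
  | cons t l ih =>
    rw [List.map_cons, ofList_cons, ofList_cons, ih, add_mul]
    simp [word, letter]

theorem ofList_map_two_mul_add_one (n : ℕ) (l : List (ℤ × ℕ)) :
    ofList (n + 1) (l.map fun t => (t.1, 2 * t.2 + 1)) = ofList n l * Y := by
  induction l with
  | nil => simp [ofList]
  | cons t l ih =>
    rw [List.map_cons, ofList_cons, ofList_cons, ih, add_mul]
    simp [word, letter, Nat.mul_add_div]

theorem ofList_smkList (c : ℤ) (m k : ℕ) : ofList m (smkList c m k) = (c : ℝ) • Smk m k X Y := by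
  induction m generalizing k with
  | zero =>
    cases k with
    | zero => simp [smkList, ofList, word, smk_zero_right_zero]
    | succ k => simp [smkList, ofList, smk_of_lt]
  | succ m ih =>
    cases k with
    | zero => rw [smkList, ofList_map_two_mul, ih, smk_succ_zero', smul_mul_assoc]
    | succ k =>
      rw [smkList, ofList_append, ofList_map_two_mul, ofList_map_two_mul_add_one, ih, ih,
        smk_succ_succ', smul_add, smul_mul_assoc, smul_mul_assoc]

/-- Left multiplication by `c` times a word of length `n`. -/
def wordMul (c : ℤ) (u n : ℕ) (l : List (ℤ × ℕ)) : List (ℤ × ℕ) :=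
  l.map fun t => (c * t.1, u * 2 ^ n + t.2 % 2 ^ n)

theorem ofList_wordMul (c : ℤ) (u m n : ℕ) (l : List (ℤ × ℕ)) :
    ofList (m + n) (wordMul c u n l) = ((c : ℝ) • word m u) * ofList n l := by
  induction l with
  | nil => simp [wordMul, ofList]
  | cons t l ih =>
    rw [wordMul, List.map_cons, ofList_cons, ← wordMul, ih, ofList_cons, mul_add, word_append]
    simp [smul_smul, mul_comm]

/-- The product of the adjoint of a polynomial of degree `m` with a polynomial of degree `n`. -/
def starMul (m n : ℕ) : List (ℤ × ℕ) → List (ℤ × ℕ) → List (ℤ × ℕ)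
  | [], _ => []
  | (c, u) :: l, l' => wordMul c (revCode m u) n l' ++ starMul m n l l'

theorem ofList_starMul (m n : ℕ) (l l' : List (ℤ × ℕ)) :
    ofList (m + n) (starMul m n l l') = star (ofList m l) * ofList n l' := by
  induction l with
  | nil => simp [starMul, ofList]
  | cons t l ih =>
    obtain ⟨c, u⟩ := t
    rw [starMul, ofList_append, ofList_wordMul, ih, ofList_cons, star_add, add_mul, star_smul',
      star_word]

end NCPoly

namespace NCPoly

/-! ### Sums of hermitian squares from Gram matrices -/

theorem smul_mem_sumHermSq {r : ℝ} (hr : 0 ≤ r) {p : NCPoly} (hp : p ∈ SumHermSq) :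
    r • p ∈ SumHermSq := by
  induction hp using AddSubmonoid.closure_induction with
  | mem x hx =>
    obtain ⟨g, rfl⟩ := hx
    refine AddSubmonoid.subset_closure ⟨√r • g, ?_⟩
    rw [star_smul', smul_mul_smul_comm, Real.mul_self_sqrt hr]
  | zero => simp
  | add x y _ _ hx hy => rw [smul_add]; exact add_mem hx hy

/-- The linear combination of `v` with coefficients `r`. -/
def linComb : List ℤ → List NCPoly → NCPoly
  | c :: r, v :: vs => (c : ℝ) • v + linComb r vs
  | _, _ => 0

/-- The hermitian form in `vs` given by the rows of the upper triangle of its Gram matrix. -/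
def quadForm : List (List ℤ) → List NCPoly → NCPoly
  | (d :: r) :: rows, v :: vs =>
    (d : ℝ) • (star v * v) + (star v * linComb r vs + star (linComb r vs) * v) + quadForm rows vs
  | _, _ => 0

/-- The Gram matrix with rows `rows`, multiplied by `d`, minus the Gram matrix of the square of the
linear form with coefficients `r`. -/
def schurStep (d : ℤ) : List ℤ → List (List ℤ) → List (List ℤ)
  | x :: r, row :: rows =>
    List.zipWith (fun a b => d * a - x * b) row (x :: r) :: schurStep d r rows
  | _, _ => []

/-- Checks that the rows have lengths `n, n - 1, …, 1`. -/
def triangular : ℕ → List (List ℤ) → Bool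
  | 0, [] => true
  | n + 1, row :: rows => Nat.beq row.length (n + 1) && triangular n rows
  | _, _ => false

/-- Checks positive definiteness of a Gram matrix of size `n` by elimination. -/
def isPosDef : ℕ → List (List ℤ) → Bool
  | n + 1, (d :: r) :: rows => decide (0 < d) && isPosDef n (schurStep d r rows)
  | _, _ => true

theorem linComb_zipWith (d x : ℤ) (r s : List ℤ) (vs : List NCPoly) (hr : r.length = vs.length)
    (hs : s.length = vs.length) :
    linComb (List.zipWith (fun a b => d * a - x * b) r s) vs
      = (d : ℝ) • linComb r vs - (x : ℝ) • linComb s vs := by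
  induction vs generalizing r s with
  | nil =>
    obtain rfl := List.length_eq_zero_iff.1 hr
    simp [linComb]
  | cons v vs ih =>
    obtain ⟨a, r, rfl⟩ := List.exists_cons_of_length_eq_add_one hr
    obtain ⟨b, s, rfl⟩ := List.exists_cons_of_length_eq_add_one hs
    rw [List.zipWith_cons_cons, linComb, linComb, linComb,
      ih _ _ (by simpa using hr) (by simpa using hs)]
    push_cast
    module

theorem triangular_schurStep (d : ℤ) (r : List ℤ) (rows : List (List ℤ))
    (h : triangular r.length rows = true) : triangular r.length (schurStep d r rows) = true := by
  induction r generalizing rows with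
  | nil =>
    cases rows with
    | nil => rfl
    | cons row rows => simp [triangular] at h
  | cons x r ih =>
    cases rows with
    | nil => simp [triangular] at h
    | cons row rows =>
      simp only [List.length_cons, triangular, Bool.and_eq_true, Nat.beq_eq] at h
      simp only [schurStep, List.length_cons, triangular, Bool.and_eq_true, Nat.beq_eq]
      exact ⟨by simp [h.1], ih rows h.2⟩

/-- Elimination is multiplied through by the pivot `d`, so that all Gram matrices stay integral. -/
theorem quadForm_schurStep (d : ℤ) (r : List ℤ) (rows : List (List ℤ)) (vs : List NCPoly)
    (hr : r.length = vs.length) (h : triangular r.length rows = true) :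
    quadForm (schurStep d r rows) vs + star (linComb r vs) * linComb r vs
      = (d : ℝ) • quadForm rows vs := by
  induction r generalizing rows vs with
  | nil =>
    obtain rfl := List.length_eq_zero_iff.1 hr.symm
    cases rows with
    | nil => simp [quadForm, schurStep, linComb]
    | cons row rows => simp [triangular] at h
  | cons x r ih =>
    obtain ⟨v, vs, rfl⟩ := List.exists_cons_of_length_eq_add_one hr.symm
    cases rows with
    | nil => simp [triangular] at h
    | cons row rows =>
      simp only [List.length_cons, triangular, Bool.and_eq_true, Nat.beq_eq] at h
      obtain ⟨a, row, rfl⟩ := List.exists_cons_of_length_eq_add_one h.1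
      have hr' : r.length = vs.length := by simpa using hr
      have h1 := ih rows vs hr' h.2
      have h2 : row.length = vs.length := by have := h.1; simp at this; omega
      rw [schurStep, List.zipWith_cons_cons, quadForm, linComb_zipWith _ _ _ _ _ h2 hr', linComb,
        quadForm, smul_add, ← h1]
      simp only [star_add, star_sub, star_smul', add_mul, mul_add, mul_sub, sub_mul,
        smul_mul_assoc, mul_smul_comm, Int.cast_sub, Int.cast_mul]
      module

theorem quadForm_mem_sumHermSq (n : ℕ) (rows : List (List ℤ)) (vs : List NCPoly)
    (hv : vs.length = n) (ht : triangular n rows = true) (hp : isPosDef n rows = true) :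
    quadForm rows vs ∈ SumHermSq := by
  induction n generalizing rows vs with
  | zero =>
    obtain rfl := List.length_eq_zero_iff.1 hv
    cases rows with
    | nil => exact zero_mem _
    | cons row rows => cases row <;> exact zero_mem _
  | succ n ih =>
    obtain ⟨v, vs, rfl⟩ := List.exists_cons_of_length_eq_add_one hv
    cases rows with
    | nil => exact zero_mem _
    | cons row rows =>
      simp only [triangular, Bool.and_eq_true, Nat.beq_eq] at ht
      obtain ⟨d, r, rfl⟩ := List.exists_cons_of_length_eq_add_one ht.1
      have hr : r.length = n := by simpa using ht.1
      have hv' : vs.length = n := by simpa using hv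
      subst hr
      rw [isPosDef, Bool.and_eq_true, decide_eq_true_eq] at hp
      have hd : (0 : ℝ) < d := by exact_mod_cast hp.1
      have h1 := quadForm_schurStep d r rows vs hv'.symm ht.2
      have h2 := ih _ vs hv' (triangular_schurStep d r rows ht.2) hp.2
      -- Completing the square: the first variable occurs only in the square of `d v + linComb r
      -- vs`, and the Schur complement is a form in the remaining ones.
      have h3 : quadForm ((d :: r) :: rows) (v :: vs) = (d : ℝ)⁻¹ •
          (star ((d : ℝ) • v + linComb r vs) * ((d : ℝ) • v + linComb r vs)
            + quadForm (schurStep d r rows) vs) := by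
        rw [eq_inv_smul_iff₀ hd.ne', quadForm, smul_add, ← h1]
        simp only [star_add, star_smul', add_mul, mul_add, smul_mul_assoc, mul_smul_comm,
          smul_smul, smul_add]
        module
      rw [h3]
      exact smul_mem_sumHermSq (inv_nonneg.2 hd.le)
        (add_mem (AddSubmonoid.subset_closure ⟨_, rfl⟩) h2)

/-! ### Gram matrices on words -/

/-- The product `p* q` of polynomials of degree `7`, or `c p* c q` for a letter `c` and polynomials
of degree `6`. -/
def pairList : Option ℕ → List (ℤ × ℕ) → List (ℤ × ℕ) → List (ℤ × ℕ)
  | none, p, q => starMul 7 7 p q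
  | some c, p, q => wordMul 1 c 13 (starMul 6 7 p (wordMul 1 c 6 q))

/-- The factor of `pairList` in the squared variables. -/
def root : Option ℕ → List (ℤ × ℕ) → NCPoly
  | none, p => sqSubst (ofList 7 p)
  | some c, p => letter c * sqSubst (ofList 6 p) * letter c

theorem sqSubst_letter (c : ℕ) : sqSubst (letter c) = letter c * letter c := by
  unfold letter
  split_ifs <;> simp [sq]

/-- For a letter `c`, the substitution turns `c p* c q` into `c² P* c² Q`; moving one outer `c` to
the end cyclically gives `(c P c)* (c Q c)`. -/
theorem cyc_pairList (c : Option ℕ) (p q : List (ℤ × ℕ)) :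
    cyc (sqSubst (ofList 14 (pairList c p q))) = cyc (star (root c p) * root c q) := by
  cases c with
  | none =>
    have h2 := ofList_starMul 7 7 p q
    rw [show (7 + 7) = 14 from rfl] at h2
    rw [pairList, h2]
    simp [root, sqSubst_star]
  | some c =>
    have h1 := ofList_wordMul 1 c 1 13 (starMul 6 7 p (wordMul 1 c 6 q))
    have h2 := ofList_starMul 6 7 p (wordMul 1 c 6 q)
    have h3 := ofList_wordMul 1 c 1 6 q
    rw [show (1 + 13) = 14 from rfl] at h1
    rw [show (6 + 7) = 13 from rfl] at h2
    rw [show (1 + 6) = 7 from rfl] at h3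
    rw [pairList, h1, h2, h3]
    simp only [word, root, one_mul, map_mul, sqSubst_star, star_mul,
      star_letter, sqSubst_letter, Int.cast_one, one_smul]
    simp only [mul_assoc]
    rw [cyc_mul_comm (letter c) (letter c * _)]
    simp only [mul_assoc]

/-- Multiplies all coefficients by `c`. -/
def scale (c : ℤ) (l : List (ℤ × ℕ)) : List (ℤ × ℕ) := l.map fun t => (c * t.1, t.2)

theorem ofList_scale (n : ℕ) (c : ℤ) (l : List (ℤ × ℕ)) :
    ofList n (scale c l) = (c : ℝ) • ofList n l := by
  induction l with
  | nil => simp [scale, ofList]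
  | cons t l ih =>
    rw [scale, List.map_cons, ← scale, ofList_cons, ih, ofList_cons, smul_add, smul_smul]
    push_cast
    rfl

/-- The off-diagonal part of a row of a Gram matrix. -/
def crossList (o : Option ℕ) (p : List (ℤ × ℕ)) : List ℤ → List (List (ℤ × ℕ)) → List (ℤ × ℕ)
  | c :: r, q :: qs => scale c (pairList o p q ++ pairList o q p) ++ crossList o p r qs
  | _, _ => []

/-- The polynomial given by a Gram matrix. -/
def gramList (o : Option ℕ) : List (List ℤ) → List (List (ℤ × ℕ)) → List (ℤ × ℕ)
  | (d :: r) :: rows, p :: ps =>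
    scale d (pairList o p p) ++ crossList o p r ps ++ gramList o rows ps
  | _, _ => []

theorem cyc_crossList (o : Option ℕ) (p : List (ℤ × ℕ)) (r : List ℤ) (qs : List (List (ℤ × ℕ))) :
    cyc (sqSubst (ofList 14 (crossList o p r qs)))
      = cyc (star (root o p) * linComb r (qs.map (root o))
          + star (linComb r (qs.map (root o))) * root o p) := by
  induction r generalizing qs with
  | nil => simp [crossList, linComb, ofList]
  | cons c r ih =>
    cases qs with
    | nil => simp [crossList, linComb, ofList]
    | cons q qs =>
      rw [crossList, ofList_append, ofList_scale, ofList_append, map_add, map_smul, map_add,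
        map_add, map_smul, map_add, cyc_pairList, cyc_pairList, ih, List.map_cons, linComb]
      simp only [map_add, map_smul, mul_add, star_add, add_mul, star_smul', mul_smul_comm,
        smul_mul_assoc]
      module

theorem cyc_gramList (o : Option ℕ) (rows : List (List ℤ)) (ps : List (List (ℤ × ℕ))) :
    cyc (sqSubst (ofList 14 (gramList o rows ps))) = cyc (quadForm rows (ps.map (root o))) := by
  induction rows generalizing ps with
  | nil => simp [gramList, quadForm, ofList]
  | cons row rows ih =>
    cases row with
    | nil => simp [gramList, quadForm, ofList]
    | cons d r =>
      cases ps with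
      | nil => simp [gramList, quadForm, ofList]
      | cons p ps =>
        rw [gramList, ofList_append, ofList_append, ofList_scale, List.map_cons, quadForm]
        simp only [map_add, map_smul]
        rw [cyc_pairList, cyc_crossList, ih, map_add]

end NCPoly

namespace NCPoly

/-! ### The certificate for `S_{14,6}` -/

/-- Symmetric combinations of the words of length `7` with three `Y`. -/
def evenBasis : List (List (ℤ × ℕ)) :=
  [[(1, 7), (1, 11), (1, 13), (1, 19), (1, 21), (1, 35), (1, 37), (1, 112), (1, 104), (1, 88),
      (1, 100), (1, 84), (1, 98), (1, 82)],
    [(1, 14), (1, 22), (1, 56), (1, 52)],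
    [(1, 67), (1, 69), (1, 97), (1, 81)],
    [(1, 76), (1, 25)],
    [(1, 74), (1, 41)],
    [(1, 73)],
    [(1, 70), (1, 49)],
    [(1, 50), (1, 38)],
    [(1, 44), (1, 26)],
    [(1, 42)],
    [(1, 28)]]

/-- The Gram matrix for `evenBasis`. -/
def evenGram : List (List ℤ) :=
  [[22, -10, -10, 46, 62, 6, -21, -34, -10, -22, 2],
    [126, -2, -18, -282, -2, 46, -34, -34, 614, -210],
    [38, -82, -130, 118, 54, -2, -2, -2, -2],
    [1166, 1518, -1202, -1066, -346, -266, 1014, -74],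
    [6718, -626, -2242, -42, -154, -8690, 494],
    [7406, 798, -2, 22, -7602, -354],
    [1510, 238, 70, 350, -50],
    [974, 6, -2714, 206],
    [438, -610, 150],
    [36134, -1422],
    [502]]

/-- Antisymmetric combinations of the words of length `7` with three `Y`. -/
def oddBasis : List (List (ℤ × ℕ)) :=
  [[(1, 7), (1, 11), (1, 13), (1, 19), (1, 21), (1, 35), (1, 37), (-1, 112), (-1, 104), (-1, 88),
      (-1, 100), (-1, 84), (-1, 98), (-1, 82)],
    [(1, 14), (1, 22), (-1, 56), (-1, 52)],
    [(1, 67), (1, 69), (-1, 97), (-1, 81)],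
    [(1, 76), (-1, 25)],
    [(1, 74), (-1, 41)],
    [(1, 70), (-1, 49)],
    [(1, 50), (-1, 38)],
    [(1, 44), (-1, 26)]]

/-- The Gram matrix for `oddBasis`. -/
def oddGram : List (List ℤ) :=
  [[32, -12, -10, -8, 8, -75, -12, 12],
    [120, 0, 40, -128, 48, -264, -136],
    [184, -40, -16, 28, 0, 0],
    [488, 944, -480, 96, -112],
    [7696, -2392, 568, 384],
    [1632, -88, -72],
    [2760, 512],
    [424]]

/-- Symmetric combinations of the words `X w X` with three `Y`, without the outer letters. -/
def evenXBasis : List (List (ℤ × ℕ)) :=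
  [[(1, 7), (1, 11), (1, 13), (1, 19), (1, 35), (1, 21), (1, 56), (1, 52), (1, 44), (1, 50), (1,
      49), (1, 42)],
    [(1, 14), (1, 22), (1, 28), (1, 26)],
    [(1, 41), (1, 37)],
    [(1, 38), (1, 25)]]

/-- The Gram matrix for `evenXBasis`. -/
def evenXGram : List (List ℤ) :=
  [[40, -28, 0, -48],
    [56, -32, 56],
    [1744, -832],
    [704]]

/-- Antisymmetric combinations of the words `X w X` with three `Y`, without the outer letters. -/
def oddXBasis : List (List (ℤ × ℕ)) :=
  [[(1, 7), (1, 11), (1, 13), (1, 19), (1, 35), (1, 21), (-1, 56), (-1, 52), (-1, 44), (-1, 50),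
      (-1, 49), (-1, 42)],
    [(1, 14), (1, 22), (-1, 28), (-1, 26)],
    [(1, 41), (-1, 37)],
    [(1, 38), (-1, 25)]]

/-- The Gram matrix for `oddXBasis`. -/
def oddXGram : List (List ℤ) :=
  [[56, -72, -130, -204],
    [320, -436, -336],
    [34240, 2832],
    [9496]]

/-- Symmetric combinations of the words `Y w Y` with four `Y`, without the outer letters. -/
def evenYBasis : List (List (ℤ × ℕ)) :=
  [[(1, 3), (1, 5), (1, 6), (1, 48), (1, 40), (1, 24)],
    [(1, 36), (1, 9)],
    [(1, 34), (1, 17)],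
    [(1, 33)],
    [(1, 20), (1, 10)],
    [(1, 18)],
    [(1, 12)]]

/-- The Gram matrix for `evenYBasis`. -/
def evenYGram : List (List ℤ) :=
  [[48, 25, 6, -86, -218, 364, 172],
    [192, -41, -50, -224, 658, -428],
    [1000, 274, -884, 952, -2404],
    [392, 462, -908, -1360],
    [4944, -9210, 1386],
    [25736, -5896],
    [12504]]

/-- Antisymmetric combinations of the words `Y w Y` with four `Y`, without the outer letters. -/
def oddYBasis : List (List (ℤ × ℕ)) :=
  [[(1, 3), (1, 5), (1, 6), (-1, 48), (-1, 40), (-1, 24)],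
    [(1, 36), (-1, 9)],
    [(1, 34), (-1, 17)],
    [(1, 20), (-1, 10)]]

/-- The Gram matrix for `oddYBasis`. -/
def oddYGram : List (List ℤ) :=
  [[44, -41, -66, -110],
    [200, 55, 66],
    [376, 372],
    [2348]]

-- The identity is checked on words of length 14, before the variables are squared; `cyc_sqSubst`
-- then transfers it to degree 28.
set_option maxRecDepth 100000 in
theorem certificate_fourteen_six : (collect 13 (smkList (-8) 14 6 ++
    scale 2 (pairList none (smkList 1 7 3) (smkList 1 7 3)) ++
    gramList none evenGram evenBasis ++ gramList none oddGram oddBasis ++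
    gramList (some 0) evenXGram evenXBasis ++ gramList (some 0) oddXGram oddXBasis ++
    gramList (some 1) evenYGram evenYBasis ++ gramList (some 1) oddYGram oddYBasis)
    .nil).isZero = true := by
  decide +kernel

theorem sqSubst_smk (m k : ℕ) : sqSubst (Smk m k X Y) = Smk m k (X ^ 2) (Y ^ 2) := by
  rw [map_smk, sqSubst_X, sqSubst_Y]

theorem root_smkList (m : ℕ) :
    root none (smkList 1 7 m) = Smk 7 m (X ^ 2) (Y ^ 2) := by
  rw [root, ofList_smkList, Int.cast_one, one_smul, sqSubst_smk]

theorem exists_sumHermSq_fourteen_six : ∃ h ∈ SumHermSq,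
    (8 : ℝ) • cyc (Smk 14 6 (X ^ 2) (Y ^ 2))
      = (2 : ℝ) • cyc (Smk 7 3 (X ^ 2) (Y ^ 2) ^ 2) + cyc h := by
  refine ⟨quadForm evenGram (evenBasis.map (root none))
    + quadForm oddGram (oddBasis.map (root none))
    + quadForm evenXGram (evenXBasis.map (root (some 0)))
    + quadForm oddXGram (oddXBasis.map (root (some 0)))
    + quadForm evenYGram (evenYBasis.map (root (some 1)))
    + quadForm oddYGram (oddYBasis.map (root (some 1))), ?_, ?_⟩
  · refine add_mem (add_mem (add_mem (add_mem (add_mem ?_ ?_) ?_) ?_) ?_) ?_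
    · exact quadForm_mem_sumHermSq 11 _ _ rfl (by decide +kernel) (by decide +kernel)
    · exact quadForm_mem_sumHermSq 8 _ _ rfl (by decide +kernel) (by decide +kernel)
    · exact quadForm_mem_sumHermSq 4 _ _ rfl (by decide +kernel) (by decide +kernel)
    · exact quadForm_mem_sumHermSq 4 _ _ rfl (by decide +kernel) (by decide +kernel)
    · exact quadForm_mem_sumHermSq 7 _ _ rfl (by decide +kernel) (by decide +kernel)
    · exact quadForm_mem_sumHermSq 4 _ _ rfl (by decide +kernel) (by decide +kernel)
  · have h := cyc_sqSubst ((cyc_ofList_eq_zero _ _ certificate_fourteen_six).trans (map_zero _).symm)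
    simp only [Nat.reduceAdd, ofList_append, map_add, cyc_gramList, ofList_scale, ofList_smkList,
      map_smul, cyc_pairList, root_smkList, map_zero, map_neg, sqSubst_smk, star_smk, star_pow,
      star_X, star_Y, ← sq, Int.cast_neg, Int.cast_ofNat, neg_smul] at h
    rw [← sub_eq_zero, ← neg_eq_zero, ← h]
    simp only [map_add]
    abel

/-! ### The certificate for `S_{14,4}` -/

set_option maxRecDepth 100000 in
theorem certificate_fourteen_four : (collect 13 (smkList (-1) 14 4 ++
    ([[(1, 65), (1, 17), (1, 33), (1, 3), (1, 5), (1, 9)],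
      [(1, 20), (1, 12), (1, 18), (1, 6), (1, 10)], [(1, 12)],
      [(1, 34), (1, 18), (1, 6), (1, 10), (1, 17), (1, 33), (1, 3), (1, 5), (1, 9)]].map
      fun p => scale 7 (pairList none p p)).flatten) .nil).isZero = true := by
  decide +kernel

theorem root_g1 : root none [(1, 65), (1, 17), (1, 33), (1, 3), (1, 5), (1, 9)] = g1 := by
  simp [root, ofList, word, letter, g1, pow_succ, mul_assoc, add_assoc]

theorem root_g2 : root none [(1, 20), (1, 12), (1, 18), (1, 6), (1, 10)] = g2 := by
  simp [root, ofList, word, letter, g2, pow_succ, mul_assoc, add_assoc]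

theorem root_g3 : root none [(1, 12)] = g3 := by
  simp [root, ofList, word, letter, g3, pow_succ, mul_assoc]

theorem root_g4 : root none [(1, 34), (1, 18), (1, 6), (1, 10), (1, 17), (1, 33), (1, 3), (1, 5),
    (1, 9)] = g4 := by
  simp [root, ofList, word, letter, g4, pow_succ, mul_assoc, add_assoc]

theorem star_sqrt_smul_mul_self {r : ℝ} (hr : 0 ≤ r) (g : NCPoly) :
    star (√r • g) * (√r • g) = r • (star g * g) := by
  rw [star_smul', smul_mul_smul_comm, Real.mul_self_sqrt hr]

theorem cycEquiv_fourteen_four : CycEquiv (Smk 14 4 (X ^ 2) (Y ^ 2))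
    (star (√7 • g1) * (√7 • g1) + star (√7 • g2) * (√7 • g2)
      + star (√7 • g3) * (√7 • g3) + star (√7 • g4) * (√7 • g4)) := by
  rw [cycEquiv_iff]
  have h := cyc_sqSubst ((cyc_ofList_eq_zero _ _ certificate_fourteen_four).trans (map_zero _).symm)
  simp only [List.map_cons, List.map_nil, List.flatten_cons, List.flatten_nil, List.append_nil,
    Nat.reduceAdd, ofList_append, map_add, ofList_scale, ofList_smkList, map_smul, cyc_pairList,
    root_g1, root_g2, root_g3, root_g4, map_zero, map_neg, sqSubst_smk, Int.cast_neg,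
    Int.cast_ofNat, Int.cast_one, neg_smul, one_smul] at h
  simp only [star_sqrt_smul_mul_self (by norm_num : (0 : ℝ) ≤ 7), map_add, map_smul]
  rw [← sub_eq_zero, ← neg_eq_zero, ← h]
  abel

theorem exists_cycEquiv_fourteen_six : ∃ h ∈ SumHermSq, CycEquiv (Smk 14 6 (X ^ 2) (Y ^ 2))
    ((1 / 10 ^ 7 : ℝ) • Smk 7 3 (X ^ 2) (Y ^ 2) ^ 2 + h) := by
  obtain ⟨h, hh, he⟩ := exists_sumHermSq_fourteen_six
  -- The Gram certificate yields the larger coefficient `2 / 8`. The excess goes into `h`, since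
  -- `S_{7,3}(X², Y²)` is self-adjoint and its square is a hermitian square.
  refine ⟨(1 / 4 - 1 / 10 ^ 7 : ℝ) • Smk 7 3 (X ^ 2) (Y ^ 2) ^ 2 + (1 / 8 : ℝ) • h,
    add_mem (smul_mem_sumHermSq (by norm_num) (AddSubmonoid.subset_closure
      ⟨Smk 7 3 (X ^ 2) (Y ^ 2), ?_⟩)) (smul_mem_sumHermSq (by norm_num) hh), ?_⟩
  · rw [star_smk, star_pow, star_pow, star_X, star_Y, sq]
  · rw [cycEquiv_iff]
    have h1 : cyc (Smk 14 6 (X ^ 2) (Y ^ 2))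
        = (1 / 8 : ℝ) • (8 : ℝ) • cyc (Smk 14 6 (X ^ 2) (Y ^ 2)) := by
      rw [smul_smul]; norm_num
    rw [h1, he]
    simp only [map_add, map_smul]
    module

end NCPoly

/-! ### Traces of `S_{m,k}` -/

section Tracial

variable {S N : Type*} [Semiring S] [AddCommMonoid N]

/-- Here `d m` plays the derivative of `p ^ m` in the direction `e`: under a trace all `m` positions
of `e` contribute equally. The factor `q` collects the powers of `p` passed during the induction. -/
theorem tracial_leibniz_mul (T : S →+ N) (hT : ∀ x y, T (x * y) = T (y * x)) (p e : S)
    (d : ℕ → S) (h0 : d 0 = 0) (hs : ∀ m, d (m + 1) = e * p ^ m + p * d m) (m : ℕ) (q : S)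
    (hq : Commute q p) : T (q * d m) = m • T (e * p ^ (m - 1) * q) := by
  induction m generalizing q with
  | zero => simp [h0]
  | succ m ih =>
    have h1 : T (q * (p * d m)) = m • T (e * p ^ m * q) := by
      rw [← mul_assoc, ih (q * p) (hq.mul_left (Commute.refl p))]
      -- For `m = 0` the truncated exponent `m - 1` is harmless, because the multiplier is zero.
      cases m with
      | zero => simp
      | succ m => rw [hq.eq, Nat.add_sub_cancel, pow_succ, ← mul_assoc, ← mul_assoc]
    rw [hs, mul_add, map_add, hT q, h1, Nat.add_sub_cancel, succ_nsmul']

theorem tracial_leibniz (T : S →+ N) (hT : ∀ x y, T (x * y) = T (y * x)) (p e : S)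
    (d : ℕ → S) (h0 : d 0 = 0) (hs : ∀ m, d (m + 1) = e * p ^ m + p * d m) (m : ℕ) :
    T (d m) = m • T (e * p ^ (m - 1)) := by
  simpa using tracial_leibniz_mul T hT p e d h0 hs m 1 (Commute.one_left p)

/-- A tracial functional applied to the coefficient of `t ^ k`. -/
noncomputable def coeffFunctional (τ : S →+ N) (k : ℕ) : Polynomial S →+ N :=
  τ.comp (Polynomial.lcoeff S k).toAddMonoidHom

theorem coeffFunctional_apply (τ : S →+ N) (k : ℕ) (p : Polynomial S) :
    coeffFunctional τ k p = τ (p.coeff k) := rfl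

theorem coeffFunctional_mul_comm (τ : S →+ N) (hτ : ∀ x y, τ (x * y) = τ (y * x)) (k : ℕ)
    (p q : Polynomial S) : coeffFunctional τ k (p * q) = coeffFunctional τ k (q * p) := by
  rw [coeffFunctional_apply, coeffFunctional_apply, Polynomial.coeff_mul, Polynomial.coeff_mul,
    map_sum, map_sum, ← Finset.Nat.sum_antidiagonal_swap]
  exact Finset.sum_congr rfl fun x _ => hτ _ _

/-- Both sides are the trace of the `t ^ k` coefficient of the derivative of `(a + t b) ^ m` in `t`.
-/
theorem tracial_mul_smk_right (τ : S →+ N) (hτ : ∀ x y, τ (x * y) = τ (y * x)) (m k : ℕ)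
    (a b : S) : (k + 1) • τ (Smk m (k + 1) a b) = m • τ (b * Smk (m - 1) k a b) := by
  have h := tracial_leibniz (coeffFunctional τ k) (coeffFunctional_mul_comm τ hτ k)
    (Polynomial.C a + Polynomial.C b * Polynomial.X) (Polynomial.C b)
    (fun m => Polynomial.derivative ((Polynomial.C a + Polynomial.C b * Polynomial.X) ^ m))
    (by simp) (fun m => by simp [pow_succ', Polynomial.derivative_mul]) m
  rw [coeffFunctional_apply, coeffFunctional_apply, Polynomial.coeff_derivative,
    Polynomial.coeff_C_mul, coeff_pencil_pow, coeff_pencil_pow] at h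
  rw [← h, ← map_nsmul]
  congr 1
  rw [nsmul_eq_mul, ← Nat.cast_succ, (Nat.cast_commute _ _).eq]

theorem tracial_mul_smk_left (τ : S →+ N) (hτ : ∀ x y, τ (x * y) = τ (y * x)) {m k : ℕ}
    (hk : k < m) (a b : S) : (m - k) • τ (Smk m k a b) = m • τ (a * Smk (m - 1) k a b) := by
  have h := tracial_mul_smk_right τ hτ m (m - 1 - k) b a
  rw [show m - 1 - k + 1 = m - k by omega] at h
  rw [smk_swap hk.le, smk_swap (by omega : k ≤ m - 1), h]

end Tracial

/-! ### Directional derivatives of traces of `Smk`. -/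

section Derivative

variable {E : Type*} [NormedRing E] [NormedAlgebra ℝ E]

/-- The generating polynomial of the derivatives of `S_{m,k}(a, b)` in the direction `e` of `a`. -/
noncomputable def smkDeriv (a b e : E) : ℕ → Polynomial E
  | 0 => 0
  | m + 1 => Polynomial.C e * (Polynomial.C a + Polynomial.C b * Polynomial.X) ^ m
      + (Polynomial.C a + Polynomial.C b * Polynomial.X) * smkDeriv a b e m

theorem hasDerivAt_smk {P : ℝ → E} {e : E} {s : ℝ} (hP : HasDerivAt P e s) (b : E) (m k : ℕ) :
    HasDerivAt (fun s => Smk m k (P s) b) ((smkDeriv (P s) b e m).coeff k) s := by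
  induction m generalizing k with
  | zero =>
    cases k with
    | zero => simpa [smk_zero_right_zero, smkDeriv] using hasDerivAt_const s (1 : E)
    | succ k => simpa [smk_of_lt, smkDeriv] using hasDerivAt_const s (0 : E)
  | succ m ih =>
    rw [smkDeriv, Polynomial.coeff_add, Polynomial.coeff_C_mul, coeff_pencil_pow, add_mul,
      Polynomial.coeff_add, Polynomial.coeff_C_mul, mul_assoc, Polynomial.coeff_C_mul]
    cases k with
    | zero =>
      simp only [smk_succ_zero, Polynomial.mul_coeff_zero, Polynomial.coeff_X_zero, zero_mul,
        mul_zero, add_zero]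
      exact hP.mul (ih 0)
    | succ k =>
      simp only [smk_succ_succ, Polynomial.coeff_X_mul]
      rw [← add_assoc]
      exact (hP.mul (ih (k + 1))).add ((ih k).const_mul b)

theorem hasDerivAt_tracial_smk (τ : E →L[ℝ] ℝ) (hτ : ∀ x y, τ (x * y) = τ (y * x)) {P : ℝ → E}
    {e : E} {s : ℝ} (hP : HasDerivAt P e s) (b : E) (m k : ℕ) :
    HasDerivAt (fun s => τ (Smk m k (P s) b)) (m * τ (e * Smk (m - 1) k (P s) b)) s := by
  have h := tracial_leibniz (coeffFunctional (τ : E →+ ℝ) k)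
    (coeffFunctional_mul_comm (τ : E →+ ℝ) hτ k)
    (Polynomial.C (P s) + Polynomial.C b * Polynomial.X) (Polynomial.C e)
    (smkDeriv (P s) b e) rfl (fun m => rfl) m
  rw [coeffFunctional_apply, coeffFunctional_apply, Polynomial.coeff_C_mul, coeff_pencil_pow,
    nsmul_eq_mul] at h
  have h1 := τ.hasFDerivAt.comp_hasDerivAt s (hasDerivAt_smk hP b m k)
  exact h ▸ h1

end Derivative

/-! ### Trace positivity over `ℝ` and `ℂ`, and the first Euler-Lagrange equation. -/

section ReTrace

open Matrix
open scoped Matrix.Norms.Frobenius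

variable {𝕜 ι : Type*} [RCLike 𝕜] [Fintype ι]

/-- The real part of the trace. -/
noncomputable def reTrace : Matrix ι ι 𝕜 →L[ℝ] ℝ :=
  LinearMap.toContinuousLinearMap
    (RCLike.reLm ∘ₗ Matrix.traceLinearMap ι ℝ 𝕜)

theorem reTrace_apply (A : Matrix ι ι 𝕜) : reTrace A = RCLike.re A.trace := rfl

theorem reTrace_mul_comm (A B : Matrix ι ι 𝕜) : reTrace (A * B) = reTrace (B * A) := by
  rw [reTrace_apply, reTrace_apply, Matrix.trace_mul_comm]

theorem reTrace_conjTranspose_mul_self (A : Matrix ι ι 𝕜) :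
    reTrace (Aᴴ * A) = ∑ i, ∑ j, ‖A i j‖ ^ 2 := by
  rw [reTrace_apply, Matrix.trace, map_sum, Finset.sum_comm]
  refine Finset.sum_congr rfl fun i _ => ?_
  rw [Matrix.diag_apply, Matrix.mul_apply, map_sum]
  refine Finset.sum_congr rfl fun j _ => ?_
  rw [Matrix.conjTranspose_apply, RCLike.star_def, RCLike.conj_mul]
  norm_cast

theorem reTrace_conjTranspose_mul_self_nonneg (A : Matrix ι ι 𝕜) : 0 ≤ reTrace (Aᴴ * A) := by
  rw [reTrace_conjTranspose_mul_self]
  positivity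

theorem eq_zero_of_reTrace_conjTranspose_mul_self {A : Matrix ι ι 𝕜} (h : reTrace (Aᴴ * A) = 0) :
    A = 0 := by
  rw [reTrace_conjTranspose_mul_self,
    Finset.sum_eq_zero_iff_of_nonneg fun i _ => by positivity] at h
  ext i j
  have h1 := h i (Finset.mem_univ i)
  rw [Finset.sum_eq_zero_iff_of_nonneg fun i _ => by positivity] at h1
  simpa using h1 j (Finset.mem_univ j)

variable [DecidableEq ι]

theorem Matrix.PosSemidef.exists_conjTranspose_mul_self {A : Matrix ι ι 𝕜} (hA : A.PosSemidef) :
    ∃ C : Matrix ι ι 𝕜, A = Cᴴ * C := by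
  open scoped MatrixOrder in
  exact CStarAlgebra.nonneg_iff_eq_star_mul_self.1 hA.nonneg

theorem Matrix.PosSemidef.exists_eq_sq {C : Matrix ι ι 𝕜} (hC : C.PosSemidef) :
    ∃ P : Matrix ι ι 𝕜, P.IsHermitian ∧ C = P ^ 2 := by
  open scoped MatrixOrder in
  exact ⟨CFC.sqrt C, (CFC.sqrt_nonneg _).posSemidef.isHermitian, (CFC.sq_sqrt C hC.nonneg).symm⟩

theorem reTrace_mul_nonneg {A B : Matrix ι ι 𝕜} (hA : A.PosSemidef) (hB : B.PosSemidef) :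
    0 ≤ reTrace (A * B) := by
  obtain ⟨C, rfl⟩ := hA.exists_conjTranspose_mul_self
  obtain ⟨D, rfl⟩ := hB.exists_conjTranspose_mul_self
  have h := reTrace_conjTranspose_mul_self_nonneg (C * Dᴴ)
  rwa [conjTranspose_mul, conjTranspose_conjTranspose, Matrix.mul_assoc, reTrace_mul_comm,
    Matrix.mul_assoc, Matrix.mul_assoc, ← Matrix.mul_assoc] at h

/-- A hermitian matrix that anticommutes with a positive semidefinite matrix is annihilated by it. -/
theorem Matrix.PosSemidef.mul_eq_zero_of_anticommute {A T : Matrix ι ι 𝕜} (hA : A.PosSemidef)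
    (hT : T.IsHermitian) (h : A * T + T * A = 0) : A * T = 0 := by
  -- Multiplying the relation by `T` and taking traces gives `2 tr (T A T) = 0`; with `A = C* C`
  -- this is the squared norm of `C T`.
  have h1 : reTrace (T * A * T) = 0 := by
    have h2 : reTrace (T * (A * T + T * A)) = 0 := by rw [h, mul_zero, map_zero]
    rw [mul_add, map_add, ← Matrix.mul_assoc, reTrace_mul_comm T (T * A)] at h2
    linarith
  obtain ⟨C, rfl⟩ := hA.exists_conjTranspose_mul_self
  have h3 : C * T = 0 := by
    apply eq_zero_of_reTrace_conjTranspose_mul_self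
    rw [conjTranspose_mul, hT.eq, ← h1]
    simp only [Matrix.mul_assoc]
  rw [Matrix.mul_assoc, h3, Matrix.mul_zero]

theorem Matrix.IsHermitian.smk {A B : Matrix ι ι 𝕜} (hA : A.IsHermitian) (hB : B.IsHermitian)
    (m k : ℕ) : (Smk m k A B).IsHermitian := by
  have h := star_smk m k A B
  rwa [star_eq_conjTranspose, star_eq_conjTranspose, star_eq_conjTranspose, hA.eq, hB.eq] at h

/-- Every hermitian matrix is a nonnegative multiple of one on the unit sphere. -/
theorem Matrix.IsHermitian.exists_eq_smul_unit {A A₀ : Matrix ι ι 𝕜} (hA : A.IsHermitian)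
    (hA₀ : A₀.IsHermitian) (h₀ : reTrace (A₀ * A₀) = 1) :
    ∃ r : ℝ, 0 ≤ r ∧ ∃ U : Matrix ι ι 𝕜, U.IsHermitian ∧ reTrace (U * U) = 1 ∧ A = r • U := by
  have hn := reTrace_conjTranspose_mul_self_nonneg A
  rw [hA.eq] at hn
  rcases hn.eq_or_lt with h | h
  · refine ⟨0, le_rfl, A₀, hA₀, h₀, ?_⟩
    rw [zero_smul]
    apply eq_zero_of_reTrace_conjTranspose_mul_self
    rw [hA.eq, h]
  · have hs := Real.sqrt_pos.2 h
    refine ⟨_, hs.le, (√(reTrace (A * A)))⁻¹ • A, ?_, ?_, (smul_inv_smul₀ hs.ne' A).symm⟩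
    · rw [IsHermitian, conjTranspose_smul, hA.eq, star_trivial]
    · rw [smul_mul_smul_comm, map_smul, ← mul_inv, Real.mul_self_sqrt hn, smul_eq_mul,
        inv_mul_cancel₀ h.ne']

/-- The Euler-Lagrange equation for the first variable of a minimizer. -/
theorem minimizer_equation_left {m k : ℕ} (hm : 1 ≤ m) (hk : k ≤ m) {A B : Matrix ι ι 𝕜}
    (hA : A.PosSemidef) (hB : B.IsHermitian) (h1 : reTrace (A * A) = 1)
    (hmin : ∀ A' : Matrix ι ι 𝕜, A'.IsHermitian → reTrace (A' * A') = 1 →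
      reTrace (Smk m k (A ^ 2) (B ^ 2)) ≤ reTrace (Smk m k (A' ^ 2) (B ^ 2))) :
    A * Smk (m - 1) k (A ^ 2) (B ^ 2)
      = (((m : ℝ) - k) / m * reTrace (Smk m k (A ^ 2) (B ^ 2))) • A := by
  set c := reTrace (Smk m k (A ^ 2) (B ^ 2)) with hc
  set S := Smk (m - 1) k (A ^ 2) (B ^ 2) with hS
  set l : ℝ := ((m : ℝ) - k) / m * c with hl
  have hAh := hA.isHermitian
  have hm0 : (m : ℝ) ≠ 0 := by positivity
  -- Homogeneity removes the norm constraint, so that no Lagrange multiplier is needed.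
  have hbound : ∀ A' : Matrix ι ι 𝕜, A'.IsHermitian →
      c * reTrace (A' * A') ^ (m - k) ≤ reTrace (Smk m k (A' ^ 2) (B ^ 2)) := by
    intro A' hA'
    obtain ⟨r, hr, U, hU, hU1, rfl⟩ := hA'.exists_eq_smul_unit hAh h1
    rw [smul_pow, smk_smul_left hk, smul_mul_smul_comm, map_smul, map_smul, hU1, smul_eq_mul,
      smul_eq_mul, mul_one, ← sq, mul_comm]
    exact mul_le_mul_of_nonneg_left (hmin U hU hU1) (by positivity)
  have hSh : S.IsHermitian := (hAh.pow 2).smk (hB.pow 2) _ _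
  -- Along `A + s H` the difference of the two sides of `hbound` is minimal, with value zero, at `s
  -- = 0`; its derivative vanishes there.
  have hvar : ∀ H : Matrix ι ι 𝕜, H.IsHermitian →
      m * reTrace ((A * H + H * A) * S) = c * ((m - k : ℕ) * reTrace (A * H + H * A)) := by
    intro H hH
    have hP : HasDerivAt (fun s : ℝ => (A + s • H) ^ 2) (A * H + H * A) 0 := by
      have h2 : HasDerivAt (fun s : ℝ => A + s • H) H 0 := by
        have h := ((hasDerivAt_id (0 : ℝ)).smul_const H).const_add A
        rwa [one_smul] at h
      have h3 := h2.mul h2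
      simp only [zero_smul, add_zero] at h3
      rw [add_comm]
      refine h3.congr_of_eventuallyEq (Filter.Eventually.of_forall fun s => ?_)
      exact sq _
    have hf := hasDerivAt_tracial_smk reTrace reTrace_mul_comm hP (B ^ 2) m k
    have hq := ((reTrace.hasFDerivAt.comp_hasDerivAt (0 : ℝ) hP).pow (m - k)).const_mul c
    have hφ := hf.sub hq
    have hloc : IsLocalMin (fun s : ℝ => reTrace (Smk m k ((A + s • H) ^ 2) (B ^ 2))
        - c * reTrace ((A + s • H) ^ 2) ^ (m - k)) 0 := by
      refine Filter.Eventually.of_forall fun s => ?_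
      have h4 := hbound (A + s • H) (hAh.add (by
        rw [IsHermitian, conjTranspose_smul, hH.eq, star_trivial]))
      simp only [zero_smul, add_zero]
      rw [sq A, h1, one_pow, mul_one, ← sq A, ← hc, sub_self]
      rw [← sq] at h4
      linarith
    have h5 : m * reTrace ((A * H + H * A) * Smk (m - 1) k ((A + (0 : ℝ) • H) ^ 2) (B ^ 2))
        - c * ((m - k : ℕ) * reTrace ((A + (0 : ℝ) • H) ^ 2) ^ (m - k - 1)
          * reTrace (A * H + H * A)) = 0 := hloc.hasDerivAt_eq_zero hφ
    rw [zero_smul, add_zero, ← hS, sq A, h1, one_pow, mul_one] at h5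
    linarith
  have hT : (S - l • 1).IsHermitian := hSh.sub (by
    rw [IsHermitian, conjTranspose_smul, conjTranspose_one, star_trivial])
  -- With `T = S - l`, the variation says `tr ((A H + H A) T) = 0`, which is `tr (H (A T + T A)) =
  -- 0`. The direction `H = A T + T A` gives `tr (H²) = 0`.
  have hanti : A * (S - l • 1) + (S - l • 1) * A = 0 := by
    have hG : (A * (S - l • 1) + (S - l • 1) * A).IsHermitian := by
      rw [IsHermitian, conjTranspose_add, conjTranspose_mul, conjTranspose_mul, hT.eq, hAh.eq,
        add_comm]
    apply eq_zero_of_reTrace_conjTranspose_mul_self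
    rw [hG.eq]
    have h7 := hvar _ hG
    generalize hH : A * (S - l • 1) + (S - l • 1) * A = H at *
    have h8 : reTrace ((A * H + H * A) * (S - l • 1)) = 0 := by
      rw [mul_sub, mul_smul_comm, mul_one, map_sub, map_smul, smul_eq_mul, hl]
      rw [Nat.cast_sub hk] at h7
      field_simp
      linarith
    rw [← h8]
    nth_rewrite 1 [← hH]
    rw [add_mul, add_mul _ _ (S - l • 1), map_add, map_add, reTrace_mul_comm (A * (S - l • 1)),
      ← mul_assoc, Matrix.mul_assoc (S - l • 1), reTrace_mul_comm (S - l • 1), add_comm]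
  have h6 := hA.mul_eq_zero_of_anticommute hT hanti
  rwa [mul_sub, mul_smul_comm, mul_one, sub_eq_zero] at h6

end ReTrace

/-! ### Existence of minimizers and descent in the degree. -/

section Minimizer

open Matrix

variable {𝕜 ι : Type*} [RCLike 𝕜] [Fintype ι]

theorem isCompact_unit_hermitian :
    IsCompact {A : Matrix ι ι 𝕜 | A.IsHermitian ∧ reTrace (A * A) = 1} := by
  have hK : IsCompact (Set.univ.pi fun _ : ι => Set.univ.pi fun _ : ι =>
      Metric.closedBall (0 : 𝕜) 1) :=
    isCompact_univ_pi fun _ => isCompact_univ_pi fun _ => isCompact_closedBall 0 1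
  refine IsCompact.of_isClosed_subset hK ?_ ?_
  · exact (isClosed_eq (Continuous.matrix_conjTranspose continuous_id) continuous_id).inter
      (isClosed_eq (reTrace.continuous.comp (continuous_id.matrix_mul continuous_id))
        continuous_const)
  · rintro A ⟨hA, h1⟩ i - j -
    have h := reTrace_conjTranspose_mul_self A
    rw [hA.eq, h1] at h
    have h2 : ‖A i j‖ ^ 2 ≤ 1 := by
      rw [h]
      exact (Finset.single_le_sum (f := fun j => ‖A i j‖ ^ 2) (fun _ _ => by positivity)
        (Finset.mem_univ j)).trans (Finset.single_le_sum (f := fun i => ∑ j, ‖A i j‖ ^ 2)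
          (fun _ _ => by positivity) (Finset.mem_univ i))
    rw [mem_closedBall_zero_iff]
    exact (sq_le_one_iff₀ (norm_nonneg _)).1 h2

theorem continuous_smk {R α : Type*} [Semiring R] [TopologicalSpace R] [IsTopologicalSemiring R]
    [TopologicalSpace α] {f g : α → R} (hf : Continuous f) (hg : Continuous g) (m k : ℕ) :
    Continuous fun x => Smk m k (f x) (g x) := by
  unfold Smk
  refine continuous_finsetSum _ fun s _ => ?_
  simp only [List.ofFn_eq_map]
  refine continuous_list_prod _ fun i _ => ?_
  split_ifs
  exacts [hg, hf]

variable [DecidableEq ι]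

/-- The Euler-Lagrange equation for the second variable of a minimizer. -/
theorem minimizer_equation_right {m k : ℕ} (hk1 : 1 ≤ k) (hk : k ≤ m) {A B : Matrix ι ι 𝕜}
    (hA : A.IsHermitian) (hB : B.PosSemidef) (h1 : reTrace (B * B) = 1)
    (hmin : ∀ B' : Matrix ι ι 𝕜, B'.IsHermitian → reTrace (B' * B') = 1 →
      reTrace (Smk m k (A ^ 2) (B ^ 2)) ≤ reTrace (Smk m k (A ^ 2) (B' ^ 2))) :
    B * Smk (m - 1) (k - 1) (A ^ 2) (B ^ 2)
      = ((k : ℝ) / m * reTrace (Smk m k (A ^ 2) (B ^ 2))) • B := by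
  have h := minimizer_equation_left (m := m) (k := m - k) (hk1.trans hk) (Nat.sub_le m k) hB hA h1
    (fun B' hB' h' => by
      rw [← smk_swap hk, ← smk_swap hk]
      exact hmin B' hB' h')
  rw [← smk_swap hk, show m - k = m - 1 - (k - 1) by omega, ← smk_swap (by omega),
    show m - 1 - (k - 1) = m - k by omega, Nat.cast_sub hk, sub_sub_cancel] at h
  exact h

/-- If `tr S_{m,k}(A², B²)` takes a negative value, then it has a negative minimum on the pairs of
hermitian matrices of norm one, attained at positive semidefinite matrices. -/
theorem exists_posSemidef_minimizer {m k : ℕ} (hk : k ≤ m) {A₀ B₀ : Matrix ι ι 𝕜}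
    (hA₀ : A₀.IsHermitian) (hB₀ : B₀.IsHermitian)
    (hneg : reTrace (Smk m k (A₀ ^ 2) (B₀ ^ 2)) < 0) :
    ∃ A B : Matrix ι ι 𝕜, A.PosSemidef ∧ B.PosSemidef ∧ reTrace (A * A) = 1 ∧ reTrace (B * B) = 1 ∧
      reTrace (Smk m k (A ^ 2) (B ^ 2)) < 0 ∧
      (∀ A' : Matrix ι ι 𝕜, A'.IsHermitian → reTrace (A' * A') = 1 →
        reTrace (Smk m k (A ^ 2) (B ^ 2)) ≤ reTrace (Smk m k (A' ^ 2) (B ^ 2))) ∧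
      (∀ B' : Matrix ι ι 𝕜, B'.IsHermitian → reTrace (B' * B') = 1 →
        reTrace (Smk m k (A ^ 2) (B ^ 2)) ≤ reTrace (Smk m k (A ^ 2) (B' ^ 2))) := by
  have hι : Nonempty ι := by
    by_contra h
    rw [not_nonempty_iff] at h
    simp [reTrace_apply, Matrix.trace] at hneg
  obtain ⟨E, hE, hE1⟩ : ∃ E : Matrix ι ι 𝕜, E.IsHermitian ∧ reTrace (E * E) = 1 := by
    obtain ⟨i⟩ := hι
    refine ⟨Matrix.single i i 1, ?_, ?_⟩
    · rw [IsHermitian, conjTranspose_single, star_one]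
    · rw [single_mul_single_same, reTrace_apply, trace_single_eq_same]
      simp
  obtain ⟨r, hr, U, hU, hU1, rfl⟩ := hA₀.exists_eq_smul_unit hE hE1
  obtain ⟨s, hs, V, hV, hV1, rfl⟩ := hB₀.exists_eq_smul_unit hE hE1
  -- Normalizing divides out nonnegative powers of `r` and `s`, so the sign survives.
  have hUV : reTrace (Smk m k (U ^ 2) (V ^ 2)) < 0 := by
    rw [smul_pow, smul_pow, smk_smul_left hk, smk_swap hk, smk_smul_left (Nat.sub_le m k),
      ← smk_swap hk, map_smul, map_smul, smul_eq_mul, smul_eq_mul] at hneg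
    by_contra! h
    exact absurd hneg (not_lt.2 (by positivity))
  have hcont : Continuous fun x : Matrix ι ι 𝕜 × Matrix ι ι 𝕜 =>
      reTrace (Smk m k (x.1 ^ 2) (x.2 ^ 2)) :=
    reTrace.continuous.comp (continuous_smk (continuous_fst.pow 2) (continuous_snd.pow 2) m k)
  obtain ⟨⟨A, B⟩, ⟨⟨hA, hA1⟩, hB, hB1⟩, hmin⟩ :=
    ((isCompact_unit_hermitian (𝕜 := 𝕜) (ι := ι)).prod isCompact_unit_hermitian).exists_isMinOn
      ⟨(U, V), ⟨hU, hU1⟩, hV, hV1⟩ hcont.continuousOn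
  rw [isMinOn_iff] at hmin
  -- The functional and the norm see only `A²` and `B²`, so a minimizer may be replaced by its
  -- absolute values.
  have habs : ∀ C : Matrix ι ι 𝕜, C.IsHermitian → ∃ P : Matrix ι ι 𝕜, P.PosSemidef ∧
      P * P = C * C := by
    intro C hC
    have h := posSemidef_conjTranspose_mul_self C
    rw [hC.eq] at h
    open scoped MatrixOrder in
    exact ⟨CFC.sqrt (C * C), (CFC.sqrt_nonneg _).posSemidef, CFC.sqrt_mul_sqrt_self _ h.nonneg⟩
  obtain ⟨P, hP, hPA⟩ := habs A hA
  obtain ⟨Q, hQ, hQB⟩ := habs B hB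
  have hPA' : P ^ 2 = A ^ 2 := by rw [sq, sq, hPA]
  have hQB' : Q ^ 2 = B ^ 2 := by rw [sq, sq, hQB]
  refine ⟨P, Q, hP, hQ, hPA ▸ hA1, hQB ▸ hB1, ?_, ?_, ?_⟩
  · rw [hPA', hQB']
    exact (hmin (U, V) ⟨⟨hU, hU1⟩, hV, hV1⟩).trans_lt hUV
  · intro A' hA' h1
    rw [hPA', hQB']
    exact hmin (A', B) ⟨⟨hA', h1⟩, hB, hB1⟩
  · intro B' hB' h1
    rw [hPA', hQB']
    exact hmin (A, B') ⟨⟨hA, hA1⟩, hB', h1⟩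

/-- Descent in the degree for the nonnegativity of `tr S_{m,k}`. -/
theorem reTrace_smk_nonneg_of_succ {m k : ℕ} (hk : k < m)
    (H : ∀ A B : Matrix ι ι 𝕜, A.PosSemidef → B.PosSemidef → 0 ≤ reTrace (Smk (m + 1) k A B))
    {A B : Matrix ι ι 𝕜} (hA : A.PosSemidef) (hB : B.PosSemidef) : 0 ≤ reTrace (Smk m k A B) := by
  by_contra! hneg
  obtain ⟨P, hP, rfl⟩ := hA.exists_eq_sq
  obtain ⟨Q, hQ, rfl⟩ := hB.exists_eq_sq
  clear hA hB
  obtain ⟨A, B, hA, hB, hA1, hB1, hc, hminA, hminB⟩ := exists_posSemidef_minimizer hk.le hP hQ hneg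
  set c := reTrace (Smk m k (A ^ 2) (B ^ 2))
  have hm : (0 : ℝ) < m := by exact_mod_cast (Nat.zero_le k).trans_lt hk
  have hkm : (k : ℝ) < m := by exact_mod_cast hk
  have h1 := minimizer_equation_left (by omega) hk.le hA hB.isHermitian hA1 hminA
  -- First-letter recursion: `A` and `B` times the two Euler-Lagrange equations add up to `S_{m,k}`.
  have h2 : Smk m k (A ^ 2) (B ^ 2) = (((m : ℝ) - k) / m * c) • A ^ 2
      + ((k : ℝ) / m * c) • B ^ 2 := by
    obtain ⟨n, rfl⟩ : ∃ n, m = n + 1 := ⟨m - 1, by omega⟩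
    rw [Nat.add_sub_cancel] at h1
    cases k with
    | zero =>
      rw [smk_succ_zero, sq A, mul_assoc, ← sq A, h1, mul_smul_comm]
      simp [sq, c]
    | succ k =>
      have h3 := minimizer_equation_right (by omega) hk.le hA.isHermitian hB hB1 hminB
      rw [Nat.add_sub_cancel, Nat.add_sub_cancel] at h3
      rw [smk_succ_succ, sq A, sq B, mul_assoc, mul_assoc, ← sq A, ← sq B, h1, h3, mul_smul_comm,
        mul_smul_comm, ← sq, ← sq]
  have h4 := tracial_mul_smk_left ((reTrace : Matrix ι ι 𝕜 →L[ℝ] ℝ) : Matrix ι ι 𝕜 →+ ℝ)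
    reTrace_mul_comm (hk.trans (Nat.lt_succ_self m)) (A ^ 2) (B ^ 2)
  have h5 : ((m + 1 - k : ℕ) : ℝ) * reTrace (Smk (m + 1) k (A ^ 2) (B ^ 2))
      = (m + 1 : ℕ) * reTrace (A ^ 2 * Smk m k (A ^ 2) (B ^ 2)) := by
    simpa [nsmul_eq_mul] using h4
  have h6 := H _ _ (hA.pow 2) (hB.pow 2)
  have h7 : 0 ≤ reTrace (A ^ 2 * Smk m k (A ^ 2) (B ^ 2)) := by
    refine nonneg_of_mul_nonneg_right (a := ((m + 1 : ℕ) : ℝ)) ?_ (by positivity)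
    rw [← h5]
    positivity
  rw [h2, mul_add, mul_smul_comm, mul_smul_comm, map_add, map_smul, map_smul, smul_eq_mul,
    smul_eq_mul] at h7
  have h8 : 0 < reTrace (A ^ 2 * A ^ 2) := by
    refine lt_of_le_of_ne (reTrace_mul_nonneg (hA.pow 2) (hA.pow 2)) fun h => ?_
    have h9 : A ^ 2 = 0 := by
      apply eq_zero_of_reTrace_conjTranspose_mul_self
      rw [(hA.pow 2).isHermitian.eq, ← h]
    rw [← sq, h9, map_zero] at hA1
    exact zero_ne_one hA1
  have h10 := reTrace_mul_nonneg (hA.pow 2) (hB.pow 2)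
  have h11 : ((m : ℝ) - k) / m * c < 0 :=
    mul_neg_of_pos_of_neg (div_pos (sub_pos.2 hkm) hm) hc
  have h12 : (k : ℝ) / m * c ≤ 0 := mul_nonpos_of_nonneg_of_nonpos (by positivity) hc.le
  -- `h7` says `λ tr A⁴ + μ tr (A² B²) ≥ 0`, impossible since `λ < 0 < tr A⁴`, `μ ≤ 0` and `tr (A²
  -- B²) ≥ 0`. Strictness of `λ < 0` is where `k < m` enters.
  nlinarith [mul_neg_of_neg_of_pos h11 h8, mul_nonneg (neg_nonneg.2 h12) h10]

end Minimizer

/-! ### Nonnegativity of `tr S_{14,k}` for even `k` -/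

section Evaluation

open Matrix

variable {𝕜 ι : Type*} [RCLike 𝕜] [Fintype ι] [DecidableEq ι]

namespace NCPoly

/-- Evaluation of noncommutative polynomials at a pair of matrices. -/
noncomputable def evalMatrix (A B : Matrix ι ι 𝕜) : NCPoly →ₐ[ℝ] Matrix ι ι 𝕜 :=
  FreeAlgebra.lift ℝ ![A, B]

@[simp] theorem evalMatrix_X (A B : Matrix ι ι 𝕜) : evalMatrix A B X = A := by
  simp [evalMatrix, X]

@[simp] theorem evalMatrix_Y (A B : Matrix ι ι 𝕜) : evalMatrix A B Y = B := by
  simp [evalMatrix, Y]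

theorem evalMatrix_star {A B : Matrix ι ι 𝕜} (hA : A.IsHermitian) (hB : B.IsHermitian)
    (p : NCPoly) : evalMatrix A B (star p) = (evalMatrix A B p)ᴴ := by
  refine FreeAlgebra.induction ℝ (Fin 2)
    (motive := fun p => evalMatrix A B (star p) = (evalMatrix A B p)ᴴ) ?_ ?_ ?_ ?_ p
  · intro r
    rw [FreeAlgebra.star_algebraMap, AlgHom.commutes, Algebra.algebraMap_eq_smul_one,
      conjTranspose_smul, conjTranspose_one, star_trivial]
  · intro i
    fin_cases i
    · change evalMatrix A B (star X) = (evalMatrix A B X)ᴴ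
      rw [star_X, evalMatrix_X, hA.eq]
    · change evalMatrix A B (star Y) = (evalMatrix A B Y)ᴴ
      rw [star_Y, evalMatrix_Y, hB.eq]
  · intro p q hp hq
    rw [star_mul, map_mul, map_mul, hp, hq, conjTranspose_mul]
  · intro p q hp hq
    rw [star_add, map_add, map_add, hp, hq, conjTranspose_add]

theorem CycEquiv.reTrace_eq {p q : NCPoly} (h : CycEquiv p q) (A B : Matrix ι ι 𝕜) :
    reTrace (evalMatrix A B p) = reTrace (evalMatrix A B q) := by
  rw [← sub_eq_zero, ← map_sub, ← map_sub]
  rw [CycEquiv] at h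
  generalize p - q = z at h ⊢
  induction h using AddSubmonoid.closure_induction with
  | mem x hx =>
    obtain ⟨p, q, rfl⟩ := hx
    rw [map_sub, map_sub, map_mul (evalMatrix A B) p q, map_mul (evalMatrix A B) q p,
      reTrace_mul_comm, sub_self]
  | zero => rw [map_zero, map_zero]
  | add x y _ _ hx hy => rw [map_add, map_add, hx, hy, add_zero]

theorem reTrace_evalMatrix_nonneg {p : NCPoly} (hp : p ∈ SumHermSq) {A B : Matrix ι ι 𝕜}
    (hA : A.IsHermitian) (hB : B.IsHermitian) : 0 ≤ reTrace (evalMatrix A B p) := by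
  induction hp using AddSubmonoid.closure_induction with
  | mem x hx =>
    obtain ⟨g, rfl⟩ := hx
    rw [map_mul, evalMatrix_star hA hB]
    exact reTrace_conjTranspose_mul_self_nonneg _
  | zero => rw [map_zero, map_zero]
  | add x y _ _ hx hy =>
    rw [map_add, map_add]
    exact add_nonneg hx hy

theorem reTrace_smk_nonneg_of_cycEquiv {m k : ℕ} {p : NCPoly} (hp : p ∈ SumHermSq)
    (h : CycEquiv (Smk m k (X ^ 2) (Y ^ 2)) p) {A B : Matrix ι ι 𝕜} (hA : A.PosSemidef)
    (hB : B.PosSemidef) : 0 ≤ reTrace (Smk m k A B) := by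
  obtain ⟨P, hP, rfl⟩ := hA.exists_eq_sq
  obtain ⟨Q, hQ, rfl⟩ := hB.exists_eq_sq
  have h1 := h.reTrace_eq P Q
  rw [map_smk, map_pow, map_pow, evalMatrix_X, evalMatrix_Y] at h1
  rw [h1]
  exact reTrace_evalMatrix_nonneg hp hP hQ

end NCPoly

/-- Each term is `tr ((B A^i B) A^l)`, a trace of a product of two positive semidefinite matrices.
The exponent `j` absorbs the leading letters `A` in the induction. -/
theorem reTrace_mul_pow_mul_smk_one_nonneg {A B : Matrix ι ι 𝕜} (hA : A.PosSemidef)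
    (hB : B.PosSemidef) (m j : ℕ) : 0 ≤ reTrace (B * A ^ j * Smk m 1 A B) := by
  induction m generalizing j with
  | zero => rw [smk_of_lt one_pos, mul_zero, map_zero]
  | succ m ih =>
    rw [smk_succ_succ, smk_zero_right, mul_add, map_add]
    refine add_nonneg ?_ ?_
    · have h := ih (j + 1)
      rwa [pow_succ, ← Matrix.mul_assoc, Matrix.mul_assoc (B * A ^ j)] at h
    · rw [← Matrix.mul_assoc]
      refine reTrace_mul_nonneg ?_ (hA.pow m)
      have h := (hA.pow j).conjTranspose_mul_mul_same B
      rwa [hB.isHermitian.eq] at h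

theorem reTrace_smk_two_nonneg {A B : Matrix ι ι 𝕜} (hA : A.PosSemidef) (hB : B.PosSemidef)
    (m : ℕ) : 0 ≤ reTrace (Smk m 2 A B) := by
  have h := tracial_mul_smk_right ((reTrace : Matrix ι ι 𝕜 →L[ℝ] ℝ) : Matrix ι ι 𝕜 →+ ℝ)
    reTrace_mul_comm m 1 A B
  have h1 : (2 : ℝ) * reTrace (Smk m 2 A B) = m * reTrace (B * Smk (m - 1) 1 A B) := by
    simpa [nsmul_eq_mul, one_add_one_eq_two] using h
  have h2 := reTrace_mul_pow_mul_smk_one_nonneg hA hB (m - 1) 0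
  rw [pow_zero, mul_one] at h2
  have h3 : 0 ≤ (m : ℝ) * reTrace (B * Smk (m - 1) 1 A B) := by positivity
  linarith

theorem reTrace_smk_fourteen_nonneg {k : ℕ} (hk : k ≤ 7) (he : Even k) {A B : Matrix ι ι 𝕜}
    (hA : A.PosSemidef) (hB : B.PosSemidef) : 0 ≤ reTrace (Smk 14 k A B) := by
  have hk' : k = 0 ∨ k = 2 ∨ k = 4 ∨ k = 6 := by
    obtain ⟨j, rfl⟩ := he
    omega
  rcases hk' with rfl | rfl | rfl | rfl
  · rw [smk_zero_right]
    have h := reTrace_mul_nonneg (hA.pow 14) PosSemidef.one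
    rwa [mul_one] at h
  · exact reTrace_smk_two_nonneg hA hB 14
  · refine NCPoly.reTrace_smk_nonneg_of_cycEquiv ?_ NCPoly.cycEquiv_fourteen_four hA hB
    exact add_mem (add_mem (add_mem (AddSubmonoid.subset_closure ⟨_, rfl⟩)
      (AddSubmonoid.subset_closure ⟨_, rfl⟩)) (AddSubmonoid.subset_closure ⟨_, rfl⟩))
      (AddSubmonoid.subset_closure ⟨_, rfl⟩)
  · obtain ⟨h, hh, he⟩ := NCPoly.exists_cycEquiv_fourteen_six
    refine NCPoly.reTrace_smk_nonneg_of_cycEquiv ?_ he hA hB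
    refine add_mem (NCPoly.smul_mem_sumHermSq (by norm_num) (AddSubmonoid.subset_closure
      ⟨Smk 7 3 (NCPoly.X ^ 2) (NCPoly.Y ^ 2), ?_⟩)) hh
    rw [star_smk, star_pow, star_pow, NCPoly.star_X, NCPoly.star_Y, sq]

theorem reTrace_smk_fourteen_nonneg_of_even {k : ℕ} (hk : k ≤ 14) (he : Even k)
    {A B : Matrix ι ι 𝕜} (hA : A.PosSemidef) (hB : B.PosSemidef) :
    0 ≤ reTrace (Smk 14 k A B) := by
  rcases le_total k 7 with h | h
  · exact reTrace_smk_fourteen_nonneg h he hA hB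
  · rw [smk_swap hk]
    exact reTrace_smk_fourteen_nonneg (by omega)
      ((Nat.even_sub hk).2 (iff_of_true (by decide) he)) hB hA

theorem reTrace_smk_thirteen_nonneg {k : ℕ} (hk : k ≤ 13) {A B : Matrix ι ι 𝕜}
    (hA : A.PosSemidef) (hB : B.PosSemidef) : 0 ≤ reTrace (Smk 13 k A B) := by
  have key : ∀ j, j < 13 → Even j → ∀ A B : Matrix ι ι 𝕜, A.PosSemidef → B.PosSemidef →
      0 ≤ reTrace (Smk 13 j A B) := fun j hj he A B hA hB =>
    reTrace_smk_nonneg_of_succ hj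
      (fun A B hA hB => reTrace_smk_fourteen_nonneg_of_even (by omega) he hA hB) hA hB
  rcases Nat.even_or_odd k with he | ho
  · refine key k (lt_of_le_of_ne hk ?_) he A B hA hB
    rintro rfl
    exact absurd he (by decide)
  · rw [smk_swap hk]
    obtain ⟨j, rfl⟩ := ho
    -- For `k = 2 j + 1` the complementary index is `13 - k = 2 (6 - j)`.
    exact key _ (by omega) ⟨6 - j, by omega⟩ B A hB hA

end Evaluation

/-! ### Assembly of the four statements. -/

theorem bmvConjectureFor_of_reTrace_nonneg {m : ℕ}
    (H : ∀ (n k : ℕ), k ≤ m → ∀ A B : Matrix (Fin n) (Fin n) ℂ, A.PosSemidef → B.PosSemidef →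
      0 ≤ reTrace (Smk m k A B)) : BMVConjectureFor m := by
  intro n A B hA hB
  refine ⟨∑ k ∈ Finset.range (m + 1), Polynomial.monomial k (reTrace (Smk m k A B)), ?_, ?_⟩
  · have h1 : A.map Polynomial.C = (Polynomial.C : ℂ →+* Polynomial ℂ).mapMatrix A := rfl
    have h2 : B.map Polynomial.C = (Polynomial.C : ℂ →+* Polynomial ℂ).mapMatrix B := rfl
    rw [pencil_pow_eq_sum, Matrix.trace_sum, Polynomial.map_sum]
    refine Finset.sum_congr rfl fun k _ => ?_
    -- `S_{m,k}(A, B)` is hermitian, so its trace is real.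
    have h3 : ((reTrace (Smk m k A B) : ℝ) : ℂ) = (Smk m k A B).trace := by
      rw [reTrace_apply]
      refine RCLike.conj_eq_iff_re.1 ?_
      rw [← RCLike.star_def, ← Matrix.trace_conjTranspose,
        (hA.isHermitian.smk hB.isHermitian m k).eq]
    rw [h1, h2, ← map_smk, Polynomial.map_monomial, Matrix.trace_smul, RingHom.mapMatrix_apply,
      ← AddMonoidHom.map_trace, smul_eq_mul, Complex.coe_algebraMap, h3,
      Polynomial.X_pow_mul, ← Polynomial.C_mul_X_pow_eq_monomial]
  · intro k
    rw [Polynomial.finsetSum_coeff]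
    refine Finset.sum_nonneg fun j hj => ?_
    rw [Polynomial.coeff_monomial]
    split_ifs
    · exact H n j (by simpa [Nat.lt_succ_iff] using hj) A B hA hB
    · exact le_rfl

theorem mem_symmHSSphere_iff {n : ℕ} {A : Matrix (Fin n) (Fin n) ℝ} :
    A ∈ symmHSSphere n ↔ A.IsHermitian ∧ reTrace (A * A) = 1 := by
  have h : A.IsHermitian ↔ A.IsSymm := by
    rw [Matrix.IsHermitian, Matrix.conjTranspose_eq_transpose_of_trivial, Matrix.IsSymm]
  rw [symmHSSphere, Set.mem_ofPred_eq, ← h]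
  refine and_congr_right fun hA => ?_
  have h1 := reTrace_conjTranspose_mul_self A
  rw [hA.eq] at h1
  rw [Real.sqrt_eq_one, h1]
  simp

theorem mainTheorem6 :
    -- the BMV conjecture for `m = 13`
    BMVConjectureFor 13 ∧
    -- the certificate for `S_{14,4}`, with the hermitian square of `√7 X⁶Y⁴X⁴` in it
    NCPoly.CycEquiv (Smk 14 4 (NCPoly.X ^ 2) (NCPoly.Y ^ 2))
      (star (√7 • NCPoly.g1) * (√7 • NCPoly.g1) + star (√7 • NCPoly.g2) * (√7 • NCPoly.g2)
        + star (√7 • NCPoly.g3) * (√7 • NCPoly.g3) + star (√7 • NCPoly.g4) * (√7 • NCPoly.g4)) ∧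
    -- the certificate for `S_{14,6}`
    (∃ h ∈ NCPoly.SumHermSq,
      NCPoly.CycEquiv (Smk 14 6 (NCPoly.X ^ 2) (NCPoly.Y ^ 2))
        ((1 / 10 ^ 7 : ℝ) • Smk 7 3 (NCPoly.X ^ 2) (NCPoly.Y ^ 2) ^ 2 + h)) ∧
    -- the minimizer equations
    (∀ (n m k : ℕ), 1 ≤ m → k ≤ m → ∀ A B : Matrix (Fin n) (Fin n) ℝ,
      A ∈ symmHSSphere n → B ∈ symmHSSphere n →
      (∀ A' ∈ symmHSSphere n, ∀ B' ∈ symmHSSphere n,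
        (Smk m k (A ^ 2) (B ^ 2)).trace ≤ (Smk m k (A' ^ 2) (B' ^ 2)).trace) →
      A.PosSemidef → B.PosSemidef →
      A * Smk (m - 1) k (A ^ 2) (B ^ 2)
          = (((m : ℝ) - k) / m * (Smk m k (A ^ 2) (B ^ 2)).trace) • A ∧
      (1 ≤ k → B * Smk (m - 1) (k - 1) (A ^ 2) (B ^ 2)
          = ((k : ℝ) / m * (Smk m k (A ^ 2) (B ^ 2)).trace) • B)) := by
  refine ⟨bmvConjectureFor_of_reTrace_nonneg fun n k hk A B hA hB =>
    reTrace_smk_thirteen_nonneg hk hA hB, NCPoly.cycEquiv_fourteen_four,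
    NCPoly.exists_cycEquiv_fourteen_six, ?_⟩
  intro n m k hm hk A B hA hB hmin hAp hBp
  have hA' := mem_symmHSSphere_iff.1 hA
  have hB' := mem_symmHSSphere_iff.1 hB
  -- Over `ℝ` the functional `reTrace` is the trace; joint minimality is used in one variable at a
  -- time.
  exact ⟨minimizer_equation_left hm hk hAp hB'.1 hA'.2
      fun A' h h1 => hmin A' (mem_symmHSSphere_iff.2 ⟨h, h1⟩) B hB,
    fun hk1 => minimizer_equation_right hk1 hk hA'.1 hBp hB'.2
      fun B' h h1 => hmin A hA B' (mem_symmHSSphere_iff.2 ⟨h, h1⟩)⟩
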